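/- Let $K$ be a field in which $2\neq 0$, and let $q\in K$ be nonzero and not a root of unity (for example, $q$ an indeterminate and $K=\mathbb{Q}(q)$, or $q\in\mathbb{C}$ with $0<|q|<1$). For $a\in K$ and $n\ge 0$ let $(a;q)_n=\prod_{k=0}^{n-1}(1-aq^k)$, and for $j\ge 1$ let $(a;q)_{-j}=1/\prod_{k=1}^{j}(1-aq^{-k})$ whenever the denominator is nonzero. For integers $n,m$ let $$\begin{bmatrix} n\\ m\end{bmatrix}=\begin{cases}\dfrac{(q;q)_n}{(q;q)_m(q;q)_{n-m}} & \text{if } 0\le m\le n,\\ 0 & \text{otherwise.}\end{cases}$$ For integers $m\ge 1$ and $n\ge 0$ put, with the cyclic convention $r_{m+1}=r_1$, $$U_m(n)=\sum_{r_1,\ldots,r_m=0}^{2n+1}\ \prod_{k=1}^m (-1)^{r_k} q^{\binom{r_k}{2}} (-q;q)_{n-r_k} \begin{bmatrix} 2n-r_k+1\\ r_{k+1}\end{bmatrix},$$ $$W_m(n)=\sum_{r_1,\ldots,r_m=0}^{2n}\ \prod_{k=1}^m (-1)^{r_k} q^{\binom{r_k}{2}} (-q;q)_{n-r_k} \begin{bmatrix}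 2n-r_k\\ r_{k+1}\end{bmatrix}.$$ Then for every integer $n\ge 1$: $$U_2(n)=0,$$ $$U_3(n)=\begin{cases}0 & \text{if } n=2k-1,\\ \dfrac{(-1)^{k-1}}{2}\,q^{9k^2+3k} & \text{if } n=2k,\end{cases}$$ $$W_2(n)=(-1)^n q^{n(3n-1)/2},$$ $$W_3(n)=\begin{cases}\dfrac{(-1)^k}{2}\left(q^{9k^2-9k+3}-3q^{9k^2-11k+3}\right) & \text{if } n=2k-1,\\[2mm] \dfrac{(-1)^{k-1}}{2}\left(q^{9k^2-3k}-3q^{9k^2-k}\right) & \text{if } n=2k.\end{cases}$$ -/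

import Mathlib

/-- The `q`-shifted factorial `(a; q)_n` for an integer index `n`:
`∏_{k=0}^{n-1} (1 - a q^k)` for `n ≥ 0`, and, as usual,
`(a; q)_{-j} = 1 / ∏_{k=1}^{j} (1 - a q^{-k})` for `j ≥ 1`. -/
def qPoch {K : Type*} [Field K] (a q : K) : ℤ → K
  | Int.ofNat n => ∏ k ∈ Finset.range n, (1 - a * q ^ k)
  | Int.negSucc j => (∏ k ∈ Finset.Icc 1 (j + 1), (1 - a * (q ^ k)⁻¹))⁻¹

/-- The `q`-binomial coefficient: `(q;q)_n / ((q;q)_m (q;q)_{n-m})` if `0 ≤ m ≤ n`,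
and `0` otherwise. -/
def qBinom {K : Type*} [Field K] (q : K) (n m : ℤ) : K :=
  if 0 ≤ m ∧ m ≤ n then qPoch q q n / (qPoch q q m * qPoch q q (n - m)) else 0

/-- The cyclic multiple sum `U_m(n)`, for `m ≥ 1`. The tuple `(r_1, …, r_m)` is indexed by
`Fin m`, where `k + 1` is addition modulo `m`, so that `r_{m+1} = r_1`. -/
def multiU {K : Type*} [Field K] (q : K) (m : ℕ) [NeZero m] (n : ℕ) : K :=
  ∑ r ∈ Fintype.piFinset (fun _ : Fin m => Finset.range (2 * n + 2)),
    ∏ k : Fin m, (-1) ^ (r k) * q ^ ((r k).choose 2) * qPoch (-q) q ((n : ℤ) - r k) *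
      qBinom q (2 * (n : ℤ) - r k + 1) (r (k + 1))

/-- The cyclic multiple sum `W_m(n)`, for `m ≥ 1`, with the same convention. -/
def multiW {K : Type*} [Field K] (q : K) (m : ℕ) [NeZero m] (n : ℕ) : K :=
  ∑ r ∈ Fintype.piFinset (fun _ : Fin m => Finset.range (2 * n + 1)),
    ∏ k : Fin m, (-1) ^ (r k) * q ^ ((r k).choose 2) * qPoch (-q) q ((n : ℤ) - r k) *
      qBinom q (2 * (n : ℤ) - r k) (r (k + 1))

/-! Write N = 2n+1 for U and N = 2n for W, and 1/(q;q)_k = 0 for k < 0. The argument decouples the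
cyclic product of `q`-binomials, sums out all indices but one, and evaluates the remaining single
sum by recurrences.

Decoupling: the product of two binomials is a `q`-Chu-Vandermonde sum (`sum_vandermonde`), the
product of three a `q`-Pfaff-Saalschütz sum (`sum_saalschutz`). The new index j enters through
1/(q;q)_{r-j}, so shifting every r by j leaves multinomial sums `multiTwo` or `multiThree` with (N,
n) replaced by (N-2j, n-j); the difference N-2n, which is 1 or 0, is preserved.

Summing out: an alternating sum of (-q;q)_{m-a} over a has a product value (`altSum_poch`). Together
with the remaining factor it forms a pair (-q;q)_{-p} (-q;q)_{p-1}, which by `qPoch_neg_reflect` is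
a power of q divided by 2. For m = 2 an elementary alternating sum is left; it vanishes when N is
odd, and for N = 2n only j = n survives. This gives `cyclicTwo_odd` and `cyclicTwo_even`.

For m = 3 a second use of Vandermonde, with base -q, makes the reflection applicable. The two
diagonal indices i, j merge into u = i + j, the sum over j is again an alternating sum, and what
remains is `fibSum`, a sum over u of [N-u, u] (-q;q)_{n-u} with parameter x (`cyclicThree_odd_eq`,
`cyclicThree_even_eq`). For N odd only x = 0 occurs, and a recurrence n -> n+2 settles it. For N
even x = 1, 2, 3 occur; a contiguous relation removes x = 3, and x = 1, 2 satisfy a first-order 2 by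
2 system in n. All these recurrences come from telescoping certificates. -/

section Basic

/-! ### Signed triangular weights, integer-index recurrences and reflection of shifted factorials.
-/

variable {K : Type*} [Field K] {q : K}

/-- The triangular exponent `k (k - 1) / 2`. -/
def tri (k : ℤ) : ℤ := k * (k - 1) / 2

/-- Exponent identities are later derived from this form, which is free of the integer division in
`tri`. -/
theorem two_mul_tri (k : ℤ) : 2 * tri k = k * (k - 1) := by
  unfold tri
  have h : (2 : ℤ) ∣ k * (k - 1) := by
    have := Int.even_mul_pred_self k
    exact this.two_dvd
  omega

/-- The signed weight `(-1)^k q^(k(k-1)/2)`. -/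
def sgnTri (q : K) (k : ℤ) : K := (-1) ^ k * q ^ tri k

/-- `1 / (q;q)_k`, extended by `0` to negative `k`. -/
def invPoch (q : K) (k : ℤ) : K := if 0 ≤ k then (qPoch q q k)⁻¹ else 0

theorem tri_add (a b : ℤ) : tri (a + b) = tri a + tri b + a * b := by
  have h1 := two_mul_tri a
  have h2 := two_mul_tri b
  have h3 := two_mul_tri (a + b)
  linarith

theorem sgnTri_add (hq0 : q ≠ 0) (a b : ℤ) :
    sgnTri q (a + b) = sgnTri q a * sgnTri q b * q ^ (a * b) := by
  unfold sgnTri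
  rw [tri_add, zpow_add₀ (neg_ne_zero.2 one_ne_zero), zpow_add₀ hq0, zpow_add₀ hq0]
  ring

@[simp] theorem tri_zero : tri 0 = 0 := rfl

@[simp] theorem tri_one : tri 1 = 0 := rfl

@[simp] theorem sgnTri_zero : sgnTri q 0 = 1 := by simp [sgnTri]

@[simp] theorem sgnTri_one : sgnTri q 1 = -1 := by simp [sgnTri]

theorem sgnTri_succ (hq0 : q ≠ 0) (a : ℤ) : sgnTri q (a + 1) = -(q ^ a * sgnTri q a) := by
  rw [sgnTri_add hq0]; simp [mul_comm]

theorem sgnTri_natCast (r : ℕ) : sgnTri q r = (-1) ^ r * q ^ (r.choose 2) := by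
  unfold sgnTri
  have h : tri (r : ℤ) = ((r.choose 2 : ℕ) : ℤ) := by
    unfold tri
    rw [Nat.choose_two_right]
    rcases r with _ | r
    · rfl
    · push_cast
      simp
  rw [h, zpow_natCast, zpow_natCast]

theorem qPoch_natCast (a : K) (n : ℕ) :
    qPoch a q (n : ℤ) = ∏ k ∈ Finset.range n, (1 - a * q ^ k) := rfl

@[simp] theorem qPoch_zero (a : K) : qPoch a q 0 = 1 := by
  have := qPoch_natCast (q := q) a 0
  simpa using this

theorem qPoch_add_one {a : K} (k : ℤ) (h : k < 0 → 1 - a * q ^ k ≠ 0) :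
    qPoch a q (k + 1) = (1 - a * q ^ k) * qPoch a q k := by
  rcases k with n | j
  · have h1 := qPoch_natCast (q := q) a n
    have h2 := qPoch_natCast (q := q) a (n + 1)
    rw [Finset.prod_range_succ, ← h1] at h2
    push_cast at h2
    simp only [Int.ofNat_eq_natCast, zpow_natCast]
    rw [h2, mul_comm]
  · have h' := h (Int.negSucc_lt_zero j)
    rw [zpow_negSucc] at h' ⊢
    rcases j with _ | j
    · have : (Int.negSucc 0 + 1) = 0 := rfl
      rw [this, qPoch_zero]
      simp only [qPoch]
      simp at h' ⊢
      rw [mul_inv_cancel₀ h']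
    · have : (Int.negSucc (j + 1) + 1) = Int.negSucc j := by omega
      rw [this]
      simp only [qPoch]
      rw [Finset.prod_Icc_succ_top (by omega : 1 ≤ j + 1 + 1), mul_inv, mul_left_comm,
        mul_inv_cancel₀ h', mul_one]

theorem zpow_ne_one (hq : ∀ j : ℕ, 0 < j → q ^ j ≠ 1) {k : ℤ} (hk : k ≠ 0) : q ^ k ≠ 1 := by
  rcases lt_or_gt_of_ne hk with h | h
  · obtain ⟨n, hn⟩ := Int.eq_ofNat_of_zero_le (by omega : 0 ≤ -k)
    have : k = -(n : ℤ) := by omega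
    rw [this, zpow_neg, zpow_natCast]
    intro h1
    exact hq n (by omega) (inv_eq_one.1 h1)
  · obtain ⟨n, hn⟩ := Int.eq_ofNat_of_zero_le h.le
    rw [hn, zpow_natCast]
    exact hq n (by omega)

theorem one_sub_zpow_ne_zero (hq : ∀ j : ℕ, 0 < j → q ^ j ≠ 1) {k : ℤ} (hk : k ≠ 0) :
    1 - q ^ k ≠ 0 := sub_ne_zero.2 (zpow_ne_one hq hk).symm

/-- From q^k = -1 follows q^(2k) = 1, hence k = 0, and then 2 = 0. This makes (-q;q)_k well behaved
at every integer k. -/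
theorem one_add_zpow_ne_zero (h2 : (2 : K) ≠ 0) (hq : ∀ j : ℕ, 0 < j → q ^ j ≠ 1) (k : ℤ) :
    1 + q ^ k ≠ 0 := by
  intro h
  by_cases hk : k = 0
  · subst hk
    apply h2
    rw [← h, zpow_zero]; norm_num
  · apply zpow_ne_one hq (mul_ne_zero two_ne_zero hk)
    rw [mul_comm, zpow_mul]
    have : q ^ k = -1 := by linear_combination h
    rw [this]; norm_num

theorem qPoch_self_add_one (hq0 : q ≠ 0) {k : ℤ} (hk : 0 ≤ k) :
    qPoch q q (k + 1) = (1 - q ^ (k + 1)) * qPoch q q k := by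
  rw [qPoch_add_one k (by omega), zpow_add₀ hq0, zpow_one, mul_comm q]

theorem qPoch_neg_add_one (h2 : (2 : K) ≠ 0) (hq0 : q ≠ 0) (hq : ∀ j : ℕ, 0 < j → q ^ j ≠ 1)
    (k : ℤ) : qPoch (-q) q (k + 1) = (1 + q ^ (k + 1)) * qPoch (-q) q k := by
  have h : 1 - -q * q ^ k = 1 + q ^ (k + 1) := by
    rw [zpow_add₀ hq0, zpow_one]; ring
  rw [qPoch_add_one k (fun _ => by rw [h]; exact one_add_zpow_ne_zero h2 hq _), h]

theorem qPoch_self_ne_zero (hq0 : q ≠ 0) (hq : ∀ j : ℕ, 0 < j → q ^ j ≠ 1) {k : ℤ} (hk : 0 ≤ k) :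
    qPoch q q k ≠ 0 := by
  obtain ⟨n, rfl⟩ := Int.eq_ofNat_of_zero_le hk
  induction n with
  | zero => simp
  | succ n ih =>
    push_cast
    rw [qPoch_self_add_one hq0 (by omega)]
    exact mul_ne_zero (one_sub_zpow_ne_zero hq (by omega)) (ih (by omega))

theorem invPoch_of_neg {k : ℤ} (hk : k < 0) : invPoch q k = 0 := if_neg (by omega)

theorem invPoch_of_nonneg {k : ℤ} (hk : 0 ≤ k) : invPoch q k = (qPoch q q k)⁻¹ := if_pos hk

@[simp] theorem invPoch_zero : invPoch q 0 = 1 := by simp [invPoch]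

/-- The value 0 at negative indices is the one compatible with the recurrence: at k = 0 the factor 1
- q^k vanishes. Support conditions in sums thus take care of themselves. -/
theorem invPoch_sub_one (hq0 : q ≠ 0) (hq : ∀ j : ℕ, 0 < j → q ^ j ≠ 1) (k : ℤ) :
    invPoch q (k - 1) = (1 - q ^ k) * invPoch q k := by
  rcases lt_trichotomy k 0 with h | h | h
  · rw [invPoch_of_neg h, invPoch_of_neg (by omega), mul_zero]
  · subst h
    rw [invPoch_of_neg (by omega)]; simp
  · rw [invPoch_of_nonneg h.le, invPoch_of_nonneg (by omega)]
    have h1 := qPoch_self_add_one hq0 (by omega : 0 ≤ k - 1)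
    rw [sub_add_cancel] at h1
    rw [h1, mul_inv, ← mul_assoc, mul_inv_cancel₀ (one_sub_zpow_ne_zero hq (by omega)), one_mul]

theorem invPoch_eq (hq0 : q ≠ 0) (hq : ∀ j : ℕ, 0 < j → q ^ j ≠ 1) {k l : ℤ} (h : k + 1 = l) :
    invPoch q k = (1 - q ^ l) * invPoch q l := by
  rw [← invPoch_sub_one hq0 hq, ← h, add_sub_cancel_right]

theorem qPoch_mul_invPoch (hq0 : q ≠ 0) (hq : ∀ j : ℕ, 0 < j → q ^ j ≠ 1) {k : ℤ} (hk : 0 ≤ k) :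
    qPoch q q k * invPoch q k = 1 := by
  rw [invPoch_of_nonneg hk, mul_inv_cancel₀ (qPoch_self_ne_zero hq0 hq hk)]

theorem qBinom_eq {n m : ℤ} (hm : 0 ≤ m) :
    qBinom q n m = qPoch q q n * invPoch q m * invPoch q (n - m) := by
  unfold qBinom
  split_ifs with h
  · rw [invPoch_of_nonneg hm, invPoch_of_nonneg (by omega), div_eq_mul_inv, mul_inv, mul_assoc]
  · rw [invPoch_of_neg (by omega : n - m < 0), mul_zero]

/-- Reflection `(-q;q)_{-p} (-q;q)_{p-1} = q^(p(p-1)/2) / 2`. -/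
theorem qPoch_neg_reflect (h2 : (2 : K) ≠ 0) (hq0 : q ≠ 0) (hq : ∀ j : ℕ, 0 < j → q ^ j ≠ 1)
    (p : ℤ) : qPoch (-q) q (-p) * qPoch (-q) q (p - 1) = q ^ tri p / 2 := by
  -- Both sides gain the factor q^p under p -> p+1, so p = 0 decides. There (-q;q)_{-1} = 1/(1 +
  -- q^0) = 1/2, the source of every 1/2 in the result.
  have key : ∀ p : ℤ, qPoch (-q) q (-(p + 1)) * qPoch (-q) q (p + 1 - 1) =
      q ^ p * (qPoch (-q) q (-p) * qPoch (-q) q (p - 1)) := by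
    intro p
    have e1 := qPoch_neg_add_one h2 hq0 hq (-(p + 1))
    have e2 := qPoch_neg_add_one h2 hq0 hq (p - 1)
    have a1 : -(p + 1) + 1 = -p := by ring
    have a2 : p - 1 + 1 = p := by ring
    rw [a1] at e1
    rw [a2] at e2
    rw [add_sub_cancel_right, e1, e2, zpow_neg]
    have := zpow_ne_zero p hq0
    field_simp
    ring
  have htri : ∀ p : ℤ, q ^ tri (p + 1) = q ^ p * q ^ tri p := by
    intro p
    rw [← zpow_add₀ hq0]
    congr 1
    have h1 := two_mul_tri p
    have h3 := two_mul_tri (p + 1)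
    linarith
  induction p using Int.induction_on with
  | zero =>
    have := qPoch_neg_add_one h2 hq0 hq (-1)
    simp only [neg_add_cancel, qPoch_zero, zpow_zero] at this
    simp only [neg_zero, qPoch_zero, one_mul, zero_sub, tri_zero, zpow_zero]
    field_simp
    linear_combination -this
  | succ i ih => rw [key, ih, htri]; ring
  | pred i ih =>
    have k1 := key (-(i : ℤ) - 1)
    have k2 := htri (-(i : ℤ) - 1)
    rw [sub_add_cancel] at k1 k2
    rw [ih, k2, mul_div_assoc] at k1
    exact (mul_left_cancel₀ (zpow_ne_zero _ hq0) k1).symm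

/-- Shifting the summation index against `1/(q;q)_{r-j}`. -/
theorem sum_shift (j R : ℕ) (h : ℤ → K) (hz : ∀ k : ℕ, R ≤ k → h k = 0) :
    ∑ r ∈ Finset.range R, invPoch q ((r : ℤ) - j) * h r =
      ∑ a ∈ Finset.range R, invPoch q a * h (a + j) := by
  have e1 : ∑ r ∈ Finset.range R, invPoch q ((r : ℤ) - j) * h r =
      ∑ r ∈ Finset.range (j + R), invPoch q ((r : ℤ) - j) * h r := by
    apply Finset.sum_subset
    · intro x; simp; omega
    · intro x _ hx
      simp only [Finset.mem_range, not_lt] at hx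
      rw [hz x hx, mul_zero]
  rw [e1, Finset.sum_range_add, Finset.sum_eq_zero, zero_add]
  · apply Finset.sum_congr rfl
    intro a _
    push_cast
    rw [add_sub_cancel_left, add_comm]
  · intro x hx
    simp only [Finset.mem_range] at hx
    rw [invPoch_of_neg (by omega), zero_mul]

end Basic

/-! ### Closed forms for alternating `q`-binomial sums. -/

section AlternatingSums

variable {K : Type*} [Field K] {q : K}

/-- The alternating `q`-binomial sum `∑_a (-1)^a q^(a(a-1)/2) f(a) / ((q;q)_a (q;q)_{L-a})`. -/
def altSum (q : K) (R : ℕ) (f : ℤ → K) (L : ℤ) : K :=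
  ∑ a ∈ Finset.range R, invPoch q a * (sgnTri q a * invPoch q (L - a) * f a)

theorem altSum_of_neg (R : ℕ) (f : ℤ → K) {L : ℤ} (hL : L < 0) : altSum q R f L = 0 := by
  apply Finset.sum_eq_zero
  intro a _
  rw [invPoch_of_neg (by omega : L - (a : ℤ) < 0)]
  ring

theorem altSum_zero {R : ℕ} (hR : 0 < R) (f : ℤ → K) : altSum q R f 0 = f 0 := by
  unfold altSum
  rw [Finset.sum_eq_single 0]
  · simp
  · intro a _ ha
    rw [invPoch_of_neg (by omega : (0 : ℤ) - (a : ℤ) < 0)]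
    ring
  · intro h; simp at h; omega

/-- The `q`-Pascal rule: split 1 - q^(L+1) = (1 - q^(L+1-a)) + q^(L+1-a) (1 - q^a) and shift a in
the second part. It drives every induction on L below. -/
theorem altSum_succ (hq0 : q ≠ 0) (hq : ∀ j : ℕ, 0 < j → q ^ j ≠ 1) {R : ℕ} (f : ℤ → K) {L : ℤ}
    (hR : L + 1 < R) :
    (1 - q ^ (L + 1)) * altSum q R f (L + 1) =
      altSum q R f L - q ^ L * altSum q R (fun a => f (a + 1)) L := by
  have hs := sum_shift (q := q) 1 R
    (fun a => q ^ (L + 1 - a) * (sgnTri q a * invPoch q (L + 1 - a) * f a)) (by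
      intro k hk
      rw [invPoch_of_neg (by omega : L + 1 - (k : ℤ) < 0)]
      ring)
  have h1 : (1 - q ^ (L + 1)) * altSum q R f (L + 1) = altSum q R f L +
      ∑ a ∈ Finset.range R, invPoch q ((a : ℤ) - (1 : ℕ)) *
        (q ^ (L + 1 - a) * (sgnTri q a * invPoch q (L + 1 - a) * f a)) := by
    unfold altSum
    rw [Finset.mul_sum, ← Finset.sum_add_distrib]
    apply Finset.sum_congr rfl
    intro a _
    push_cast
    rw [invPoch_sub_one hq0 hq a,
      invPoch_eq hq0 hq (by ring : L - (a : ℤ) + 1 = L + 1 - a)]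
    have : q ^ (L + 1) = q ^ (L + 1 - a) * q ^ (a : ℤ) := by
      rw [← zpow_add₀ hq0]; congr 1; ring
    rw [this]
    ring
  rw [h1, hs, sub_eq_add_neg, add_right_inj]
  unfold altSum
  rw [Finset.mul_sum, ← Finset.sum_neg_distrib]
  apply Finset.sum_congr rfl
  intro a _
  push_cast
  rw [sgnTri_succ hq0]
  have e1 : L + 1 - ((a : ℤ) + 1) = L - a := by ring
  have e2 : q ^ L = q ^ (L - a) * q ^ (a : ℤ) := by
    rw [← zpow_add₀ hq0]; congr 1; ring
  rw [e1, e2]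
  ring

theorem altSum_const_mul (R : ℕ) (f : ℤ → K) (x : K) (L : ℤ) :
    altSum q R (fun a => x * f a) L = x * altSum q R f L := by
  unfold altSum
  rw [Finset.mul_sum]
  apply Finset.sum_congr rfl
  intro a _
  ring

/-- For constant f the Pascal rule multiplies the sum by (1 - q^L)/(1 - q^(L+1)), which is 0 at L =
0. -/
theorem altSum_one (hq0 : q ≠ 0) (hq : ∀ j : ℕ, 0 < j → q ^ j ≠ 1) {R : ℕ} (hR0 : 0 < R) {L : ℤ}
    (hR : L < R) : altSum q R (fun _ => 1) L = if L = 0 then 1 else 0 := by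
  rcases lt_or_ge L 0 with h | h
  · rw [altSum_of_neg _ _ h, if_neg h.ne]
  · obtain ⟨n, rfl⟩ := Int.eq_ofNat_of_zero_le h
    rcases n with _ | n
    · exact (altSum_zero hR0 _).trans (by simp)
    · have hne := one_sub_zpow_ne_zero hq (by omega : (n : ℤ) + 1 ≠ 0)
      push_cast at hR ⊢
      rw [if_neg (by omega : ¬ (n : ℤ) + 1 = 0)]
      apply (mul_eq_zero.1 _).resolve_left hne
      rw [altSum_succ hq0 hq _ hR]
      clear hne
      induction n with
      | zero => simp
      | succ n ih =>
        have hne := one_sub_zpow_ne_zero hq (by omega : (n : ℤ) + 1 ≠ 0)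
        have ih' := ih (by omega) (by push_cast at hR; omega)
        rw [← altSum_succ hq0 hq _ (by push_cast at hR; omega)] at ih'
        have := (mul_eq_zero.1 ih').resolve_left hne
        push_cast
        rw [this]; ring

/-- The multiplier is now (1 - q^(L-1))/(1 - q^(L+1)); it vanishes at L = 1, so exactly L = 0 and L
= 1 survive. -/
theorem altSum_zpow_neg (hq0 : q ≠ 0) (hq : ∀ j : ℕ, 0 < j → q ^ j ≠ 1) {R : ℕ} (hR0 : 0 < R)
    {L : ℤ} (hR : L < R) : altSum q R (fun a => q ^ (-a)) L =
      if L = 0 then 1 else if L = 1 then -q⁻¹ else 0 := by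
  have step : ∀ n : ℕ, (n : ℤ) + 1 < R → (1 - q ^ ((n : ℤ) + 1)) *
      altSum q R (fun a => q ^ (-a)) ((n : ℤ) + 1) =
      (1 - q ^ ((n : ℤ) - 1)) * altSum q R (fun a => q ^ (-a)) n := by
    intro n hn
    rw [altSum_succ hq0 hq _ hn]
    have : (fun a : ℤ => q ^ (-(a + 1))) = fun a => q⁻¹ * q ^ (-a) := by
      funext a
      rw [← zpow_neg_one, ← zpow_add₀ hq0]
      congr 1; ring
    rw [this, altSum_const_mul, zpow_sub₀ hq0, zpow_one]
    field_simp
  rcases lt_or_ge L 0 with h | h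
  · rw [altSum_of_neg _ _ h, if_neg h.ne, if_neg (by omega)]
  · obtain ⟨n, rfl⟩ := Int.eq_ofNat_of_zero_le h
    have h0 : altSum q R (fun a => q ^ (-a)) 0 = 1 := by
      rw [altSum_zero hR0]; simp
    rcases n with _ | n
    · simpa using h0
    rw [if_neg (by push_cast; omega)]
    induction n with
    | zero =>
      have hne := one_sub_zpow_ne_zero hq (by omega : (1 : ℤ) ≠ 0)
      have s := step 0 (by push_cast at hR ⊢; omega)
      simp only [Nat.cast_zero, zero_add, zero_sub, h0] at s
      simp only [zero_add, Nat.cast_one, if_true]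
      apply mul_left_cancel₀ hne
      rw [s, zpow_neg_one, zpow_one]
      field_simp
      ring
    | succ n ih =>
      have hne := one_sub_zpow_ne_zero hq (by omega : (n : ℤ) + 1 + 1 ≠ 0)
      have s := step (n + 1) (by push_cast at hR ⊢; omega)
      rw [ih (by omega) (by push_cast at hR ⊢; omega)] at s
      rw [if_neg (by push_cast; omega)]
      push_cast at s ⊢
      apply (mul_eq_zero.1 _).resolve_left hne
      rw [s]
      split_ifs with h1
      · have : (n : ℤ) + 1 - 1 = 0 := by omega
        rw [this]; simp
      · simp

/-- A `q`-difference of order L of a shifted factorial is again one, since shifting a amounts to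
lowering m. Keeping `p` abstract, with its recurrence needed only from m - L on, covers (-q;q)_k at
all integers and (q;q)_k at k ≥ 0. -/
theorem altSum_poch (hq0 : q ≠ 0) (hq : ∀ j : ℕ, 0 < j → q ^ j ≠ 1) (y : K) (p : ℤ → K) {R : ℕ}
    (hR0 : 0 < R) {L m : ℤ} (hR : L < R)
    (hp : ∀ k : ℤ, m - L ≤ k → p (k + 1) = (1 - y * q ^ (k + 1)) * p k) :
    altSum q R (fun a => p (m - a)) L =
      invPoch q L * ((-y) ^ L.toNat * q ^ (L * m - tri L) * p (m - L)) := by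
  rcases lt_or_ge L 0 with h | h
  · rw [altSum_of_neg _ _ h, invPoch_of_neg h, zero_mul]
  · obtain ⟨n, rfl⟩ := Int.eq_ofNat_of_zero_le h
    rw [Int.toNat_natCast]
    clear h
    induction n generalizing m with
    | zero => rw [Nat.cast_zero, altSum_zero hR0]; simp
    | succ n ih =>
      push_cast at hR hp ⊢
      have hne := one_sub_zpow_ne_zero hq (by omega : (n : ℤ) + 1 ≠ 0)
      apply mul_left_cancel₀ hne
      rw [altSum_succ hq0 hq _ hR, ih (by omega) (fun k hk => hp k (by omega))]
      have e : (fun a : ℤ => p (m - (a + 1))) = fun a => p (m - 1 - a) := by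
        funext a; congr 1; ring
      rw [e, ih (by omega) (fun k hk => hp k (by omega))]
      rw [invPoch_eq hq0 hq (by ring : (n : ℤ) + 1 = n + 1)]
      have hpm := hp (m - (n + 1)) le_rfl
      have e1 : m - ((n : ℤ) + 1) + 1 = m - n := by ring
      have e2 : m - 1 - (n : ℤ) = m - (n + 1) := by ring
      rw [e1] at hpm
      rw [e2, hpm]
      have t : tri ((n : ℤ) + 1) = tri n + n := by rw [tri_add]; simp
      have e3 : ((n : ℤ) + 1) * m - tri (n + 1) = (n * m - tri n) + (m - n) := by rw [t]; ring
      have e4 : (n : ℤ) * (m - 1) - tri n = (n * m - tri n) - n := by ring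
      rw [e3, e4]
      generalize (n : ℤ) * m - tri n = E
      simp only [zpow_add₀ hq0, zpow_sub₀ hq0, zpow_one, pow_succ]
      have hx := zpow_ne_zero (n : ℤ) hq0
      generalize q ^ (n : ℤ) = x at hx ⊢
      field_simp
      ring

/-- Same induction with y = 1 and the extra weight q^(-a); the value is no longer a pure product,
but its last factor is consistent with the Pascal rule. -/
theorem altSum_zpow_neg_mul_poch (hq0 : q ≠ 0) (hq : ∀ j : ℕ, 0 < j → q ^ j ≠ 1) (p : ℤ → K)
    {R : ℕ} (hR0 : 0 < R) {L m : ℤ} (hR : L < R)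
    (hp : ∀ k : ℤ, m - L ≤ k → p (k + 1) = (1 - q ^ (k + 1)) * p k) :
    altSum q R (fun a => q ^ (-a) * p (m - a)) L =
      invPoch q L * ((-1) ^ L.toNat * q ^ (L * m - tri L) * p (m - L)) *
        (1 + (1 - q ^ L) * q ^ (-m - 1)) := by
  rcases lt_or_ge L 0 with h | h
  · rw [altSum_of_neg _ _ h, invPoch_of_neg h, zero_mul, zero_mul]
  · obtain ⟨n, rfl⟩ := Int.eq_ofNat_of_zero_le h
    rw [Int.toNat_natCast]
    clear h
    induction n generalizing m with
    | zero => rw [Nat.cast_zero, altSum_zero hR0]; simp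
    | succ n ih =>
      push_cast at hR hp ⊢
      have hne := one_sub_zpow_ne_zero hq (by omega : (n : ℤ) + 1 ≠ 0)
      apply mul_left_cancel₀ hne
      rw [altSum_succ hq0 hq _ hR, ih (by omega) (fun k hk => hp k (by omega))]
      have e : (fun a : ℤ => q ^ (-(a + 1)) * p (m - (a + 1))) =
          fun a => q⁻¹ * (q ^ (-a) * p (m - 1 - a)) := by
        funext a
        rw [← mul_assoc, ← zpow_neg_one, ← zpow_add₀ hq0]
        congr 2 <;> ring
      rw [e, altSum_const_mul, ih (by omega) (fun k hk => hp k (by omega))]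
      rw [invPoch_eq hq0 hq (by ring : (n : ℤ) + 1 = n + 1)]
      have hpm := hp (m - (n + 1)) le_rfl
      have e1 : m - ((n : ℤ) + 1) + 1 = m - n := by ring
      have e2 : m - 1 - (n : ℤ) = m - (n + 1) := by ring
      rw [e1] at hpm
      rw [e2, hpm]
      have t : tri ((n : ℤ) + 1) = tri n + n := by rw [tri_add]; simp
      have e3 : ((n : ℤ) + 1) * m - tri (n + 1) = (n * m - tri n) + (m - n) := by rw [t]; ring
      have e4 : (n : ℤ) * (m - 1) - tri n = (n * m - tri n) - n := by ring
      have e5 : -(m - 1) - 1 = -m := by ring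
      rw [e3, e4, e5]
      generalize (n : ℤ) * m - tri n = E
      simp only [zpow_add₀ hq0, zpow_sub₀ hq0, zpow_neg, zpow_one, pow_succ]
      have hx := zpow_ne_zero (n : ℤ) hq0
      have hM := zpow_ne_zero m hq0
      generalize q ^ (n : ℤ) = x at hx ⊢
      generalize q ^ m = M at hM ⊢
      field_simp
      ring

end AlternatingSums

/-! ### The `q`-Chu-Vandermonde and `q`-Pfaff-Saalschütz sums by creative telescoping. -/

section Summations

variable {K : Type*} [Field K] {q : K}

/-- The summand of the `q`-Chu-Vandermonde sum `sum_vandermonde`. -/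
def vandTerm (q y : K) (p : ℤ → K) (N s r : ℤ) (j : ℕ) : K :=
  (-y) ^ j * q ^ (tri (j + 1) + (N - r - s) * j) * p (N - j) *
    (invPoch q j * invPoch q (r - j) * invPoch q (s - j))

/-- A first-order recurrence in r, up to a difference in j of an explicit multiple of the summand.
For j > r+1 everything vanishes, so the recurrence for `p` is needed only for j ≤ r+1. -/
theorem vandTerm_telescope (hq0 : q ≠ 0) (hq : ∀ j : ℕ, 0 < j → q ^ j ≠ 1) (y : K) (p : ℤ → K)
    {N s : ℤ} {r j : ℕ} (hp : j ≤ r + 1 → p (N - j + 1) = (1 - y * q ^ (N - j + 1)) * p (N - j)) :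
    (1 - q ^ (r + 1 : ℤ)) * (1 - y * q ^ (N - r)) * vandTerm q y p N s (r + 1) j -
      (1 - y * q ^ (N - r - s)) * vandTerm q y p N s r j =
    -((-y) ^ (j + 1) * q ^ (tri (j + 1 + 1) + (N - r - 1 - s) * (j + 1)) * p (N - j) *
      (invPoch q j * invPoch q (r - j) * invPoch q (s - (j + 1)))) +
    (-y) ^ j * q ^ (tri (j + 1) + (N - r - 1 - s) * j) * p (N - j + 1) *
      (invPoch q (j - 1) * invPoch q (r + 1 - j) * invPoch q (s - j)) := by
  unfold vandTerm
  by_cases hj : j ≤ r + 1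
  · rw [hp hj, invPoch_eq hq0 hq (by ring : (r : ℤ) - j + 1 = r + 1 - j),
      invPoch_eq hq0 hq (by ring : s - ((j : ℤ) + 1) + 1 = s - j),
      invPoch_sub_one hq0 hq]
    have e1 : tri ((j : ℤ) + 1) + (N - (r + 1) - s) * j =
      tri ((j : ℤ) + 1) + (N - r - 1 - s) * j := by ring
    have e2 : tri ((j : ℤ) + 1) + (N - r - s) * j =
      tri ((j : ℤ) + 1) + (N - r - 1 - s) * j + j := by ring
    have e3 : tri ((j : ℤ) + 1 + 1) + (N - r - 1 - s) * (j + 1) =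
      tri ((j : ℤ) + 1) + (N - r - 1 - s) * j + (j + N - r - s) := by
      rw [tri_add (j + 1) 1, tri_one]; ring
    rw [e1, e2, e3]
    generalize tri ((j : ℤ) + 1) + (N - r - 1 - s) * j = E
    generalize p (N - j) = p0
    generalize invPoch q ((r : ℤ) + 1 - j) = g1
    generalize invPoch q (s - j) = g2
    generalize invPoch q (j : ℤ) = g3
    simp only [zpow_add₀ hq0, zpow_sub₀ hq0, zpow_one, pow_succ]
    have hx := zpow_ne_zero (j : ℤ) hq0
    have hr := zpow_ne_zero (r : ℤ) hq0
    have hs := zpow_ne_zero s hq0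
    have hN := zpow_ne_zero N hq0
    generalize q ^ (j : ℤ) = x at hx ⊢
    generalize q ^ (r : ℤ) = a at hr ⊢
    generalize q ^ s = b at hs ⊢
    generalize q ^ N = M at hN ⊢
    field_simp
    ring
  · rw [invPoch_of_neg (by omega : (r : ℤ) + 1 - j < 0),
      invPoch_of_neg (by omega : (r : ℤ) - j < 0)]
    ring

/-- The `q`-Chu-Vandermonde sum. -/
theorem sum_vandermonde (hq0 : q ≠ 0) (hq : ∀ j : ℕ, 0 < j → q ^ j ≠ 1) (y : K) (p : ℤ → K)
    {N : ℤ} {r s R : ℕ} (hR : r < R)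
    (hp : ∀ k : ℤ, N - r - s ≤ k → p (k + 1) = (1 - y * q ^ (k + 1)) * p k)
    (hy : ∀ k : ℤ, N - r - s ≤ k → 1 - y * q ^ (k + 1) ≠ 0) :
    p (N - r - s) * ∑ j ∈ Finset.range R, vandTerm q y p N s r j =
      invPoch q r * invPoch q s * p (N - r) * p (N - s) := by
  induction r with
  | zero =>
    rw [Finset.sum_eq_single 0]
    · simp [vandTerm]; ring
    · intro j _ hj
      unfold vandTerm
      rw [invPoch_of_neg (by push_cast; omega : ((0 : ℕ) : ℤ) - (j : ℤ) < 0)]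
      ring
    · intro h; simp at h; omega
  | succ r ih =>
    have ih' := ih (by omega) (fun k hk => hp k (by push_cast; omega))
      (fun k hk => hy k (by push_cast; omega))
    have tel : ∑ j ∈ Finset.range R,
        ((1 - q ^ (r + 1 : ℤ)) * (1 - y * q ^ (N - r)) * vandTerm q y p N s (r + 1) j -
          (1 - y * q ^ (N - r - s)) * vandTerm q y p N s r j) = 0 := by
      have := Finset.sum_range_sub (fun j : ℕ =>
        -((-y) ^ j * q ^ (tri (j + 1) + (N - r - 1 - s) * j) * p (N - j + 1) *
          (invPoch q (j - 1) * invPoch q (r + 1 - j) * invPoch q (s - j)))) R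
      -- The boundary terms vanish: 1/(q;q)_{r+1-R} at the top, 1/(q;q)_{-1} at the bottom.
      rw [invPoch_of_neg (by omega : (r : ℤ) + 1 - (R : ℤ) < 0),
        invPoch_of_neg (by simp : ((0 : ℕ) : ℤ) - 1 < 0)] at this
      simp only [mul_zero, zero_mul, neg_zero, sub_zero] at this
      rw [← this]
      apply Finset.sum_congr rfl
      intro j _
      rw [vandTerm_telescope hq0 hq y p (fun hj => hp (N - j) (by push_cast; omega))]
      push_cast
      have e1 : N - ((j : ℤ) + 1) + 1 = N - j := by ring
      have e2 : (j : ℤ) + 1 - 1 = j := by ring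
      have e3 : (r : ℤ) + 1 - (j + 1) = r - j := by ring
      rw [e1, e2, e3]
      ring
    rw [Finset.sum_sub_distrib, ← Finset.mul_sum, ← Finset.mul_sum, sub_eq_zero] at tel
    push_cast at hp hy ⊢
    have h1 := hp (N - (r + 1) - s) le_rfl
    have h2 := hp (N - (r + 1)) (by omega)
    have n2 := hy (N - (r + 1)) (by omega)
    have n3 := one_sub_zpow_ne_zero hq (by omega : (r : ℤ) + 1 ≠ 0)
    have e1 : N - ((r : ℤ) + 1) - s + 1 = N - r - s := by ring
    have e2 : N - ((r : ℤ) + 1) + 1 = N - r := by ring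
    rw [e1] at h1
    rw [e2] at h2 n2
    apply mul_left_cancel₀ (mul_ne_zero n3 n2)
    rw [h1, h2, invPoch_eq hq0 hq (rfl : (r : ℤ) + 1 = r + 1)] at ih'
    linear_combination ih' + p (N - (r + 1) - s) * tel

/-- The summand of the `q`-Pfaff-Saalschütz sum `sum_saalschutz`. -/
def saalTerm (q : K) (N r s t : ℤ) (j : ℕ) : K :=
  q ^ (j * j + (N - r - s - t) * j) * qPoch q q (N - j) * (invPoch q j * invPoch q (r - j) *
    invPoch q (s - j) * invPoch q (t - j) * invPoch q (N + j - r - s - t))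

/-- The analogous recurrence in t. The bound on t keeps N - j nonnegative wherever the terms are
nonzero. -/
theorem saalTerm_telescope (hq0 : q ≠ 0) (hq : ∀ j : ℕ, 0 < j → q ^ j ≠ 1) {N r s : ℤ} {t j : ℕ}
    (ht : (t : ℤ) + 1 ≤ N) :
    (1 - q ^ (t + 1 : ℤ)) * (1 - q ^ (N - t)) * saalTerm q N r s (t + 1) j -
      (1 - q ^ (N - r - t)) * (1 - q ^ (N - s - t)) * saalTerm q N r s t j =
    -(q ^ ((j + 1) * (j + 1) + (N - r - s - t - 1) * (j + 1) : ℤ) * qPoch q q (N - j) *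
      (invPoch q j * invPoch q (r - (j + 1)) * invPoch q (s - (j + 1)) * invPoch q (t - j) *
        invPoch q (N + j - r - s - t))) +
    q ^ (j * j + (N - r - s - t - 1) * j) * qPoch q q (N - j + 1) *
      (invPoch q (j - 1) * invPoch q (r - j) * invPoch q (s - j) * invPoch q (t + 1 - j) *
        invPoch q (N + j - r - s - t - 1)) := by
  unfold saalTerm
  by_cases hj : j ≤ t + 1
  · rw [qPoch_self_add_one hq0 (by omega : 0 ≤ N - (j : ℤ)),
      invPoch_eq hq0 hq (by ring : (t : ℤ) - j + 1 = t + 1 - j),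
      invPoch_eq hq0 hq (by ring : r - ((j : ℤ) + 1) + 1 = r - j),
      invPoch_eq hq0 hq (by ring : s - ((j : ℤ) + 1) + 1 = s - j),
      invPoch_eq hq0 hq (by ring : N + j - r - s - (t + 1) + 1 = N + j - r - s - t),
      invPoch_sub_one hq0 hq, invPoch_sub_one hq0 hq]
    have e1 : (j : ℤ) * j + (N - r - s - (t + 1)) * j =
      j * j + (N - r - s - t - 1) * j := by ring
    have e2 : (j : ℤ) * j + (N - r - s - t) * j =
      j * j + (N - r - s - t - 1) * j + j := by ring
    have e3 : ((j : ℤ) + 1) * (j + 1) + (N - r - s - t - 1) * (j + 1) =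
      j * j + (N - r - s - t - 1) * j + (j + j + N - r - s - t) := by ring
    rw [e1, e2, e3]
    generalize (j : ℤ) * j + (N - r - s - t - 1) * j = E
    generalize qPoch q q (N - j) = p0
    generalize invPoch q ((t : ℤ) + 1 - j) = g1
    generalize invPoch q (s - j) = g2
    generalize invPoch q (j : ℤ) = g3
    generalize invPoch q (r - j) = g4
    generalize invPoch q (N + j - r - s - t) = g5
    simp only [zpow_add₀ hq0, zpow_sub₀ hq0, zpow_one]
    have hx := zpow_ne_zero (j : ℤ) hq0
    have ht := zpow_ne_zero (t : ℤ) hq0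
    have hs := zpow_ne_zero s hq0
    have hr := zpow_ne_zero r hq0
    have hN := zpow_ne_zero N hq0
    generalize q ^ (j : ℤ) = x at hx ⊢
    generalize q ^ (t : ℤ) = a at ht ⊢
    generalize q ^ s = b at hs ⊢
    generalize q ^ r = c at hr ⊢
    generalize q ^ N = M at hN ⊢
    field_simp
    ring
  · rw [invPoch_of_neg (by omega : (t : ℤ) + 1 - j < 0),
      invPoch_of_neg (by omega : (t : ℤ) - j < 0)]
    ring

/-- The `q`-Pfaff-Saalschütz sum. -/
theorem sum_saalschutz (hq0 : q ≠ 0) (hq : ∀ j : ℕ, 0 < j → q ^ j ≠ 1) {N r s t R : ℕ}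
    (hr : r ≤ N) (hs : s ≤ N) (ht : t ≤ N) (hR : N < R) :
    ∑ j ∈ Finset.range R, saalTerm q N r s t j =
      qPoch q q (N - r) * qPoch q q (N - s) * qPoch q q (N - t) *
        (invPoch q r * invPoch q s * invPoch q t) *
        (invPoch q (N - r - s) * invPoch q (N - s - t) * invPoch q (N - t - r)) := by
  induction t with
  | zero =>
    rw [Finset.sum_eq_single 0]
    · have e1 := qPoch_mul_invPoch hq0 hq (by omega : 0 ≤ (N : ℤ) - r)
      have e2 := qPoch_mul_invPoch hq0 hq (by omega : 0 ≤ (N : ℤ) - s)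
      simp only [saalTerm, Nat.cast_zero, mul_zero, add_zero, zpow_zero, sub_zero, invPoch_zero,
        one_mul, mul_one]
      linear_combination (-qPoch q q (N : ℤ) * invPoch q (r : ℤ) * invPoch q (s : ℤ) *
        invPoch q ((N : ℤ) - r - s)) * (e1 * qPoch q q ((N : ℤ) - s) * invPoch q ((N : ℤ) - s) + e2)
    · intro j _ hj
      unfold saalTerm
      rw [invPoch_of_neg (by push_cast; omega : ((0 : ℕ) : ℤ) - (j : ℤ) < 0)]
      ring
    · intro h; simp at h; omega
  | succ t ih =>
    have ih' := ih (by omega)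
    have tel : ∑ j ∈ Finset.range R,
        ((1 - q ^ (t + 1 : ℤ)) * (1 - q ^ ((N : ℤ) - t)) * saalTerm q N r s (t + 1) j -
          (1 - q ^ ((N : ℤ) - r - t)) * (1 - q ^ ((N : ℤ) - s - t)) * saalTerm q N r s t j) = 0 := by
      have := Finset.sum_range_sub (fun j : ℕ =>
        -(q ^ (j * j + ((N : ℤ) - r - s - t - 1) * j) * qPoch q q (N - j + 1) *
          (invPoch q (j - 1) * invPoch q (r - j) * invPoch q (s - j) * invPoch q (t + 1 - j) *
            invPoch q (N + j - r - s - t - 1)))) R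
      rw [invPoch_of_neg (by omega : (t : ℤ) + 1 - (R : ℤ) < 0),
        invPoch_of_neg (by simp : ((0 : ℕ) : ℤ) - 1 < 0)] at this
      simp only [mul_zero, zero_mul, neg_zero, sub_zero] at this
      rw [← this]
      apply Finset.sum_congr rfl
      intro j _
      rw [saalTerm_telescope hq0 hq (by omega)]
      push_cast
      have e1 : (N : ℤ) - ((j : ℤ) + 1) + 1 = N - j := by ring
      have e2 : (j : ℤ) + 1 - 1 = j := by ring
      have e3 : (t : ℤ) + 1 - (j + 1) = t - j := by ring
      have e4 : (N : ℤ) + (j + 1) - r - s - t - 1 = N + j - r - s - t := by ring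
      rw [e1, e2, e3, e4]
      ring
    rw [Finset.sum_sub_distrib, ← Finset.mul_sum, ← Finset.mul_sum, sub_eq_zero] at tel
    push_cast
    have h2 := qPoch_self_add_one hq0 (by omega : 0 ≤ (N : ℤ) - (t + 1))
    have n2 := one_sub_zpow_ne_zero hq (by omega : (N : ℤ) - t ≠ 0)
    have n3 := one_sub_zpow_ne_zero hq (by omega : (t : ℤ) + 1 ≠ 0)
    have e2 : (N : ℤ) - ((t : ℤ) + 1) + 1 = N - t := by ring
    rw [e2] at h2
    apply mul_left_cancel₀ (mul_ne_zero n3 n2)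
    rw [h2, invPoch_eq hq0 hq (rfl : (t : ℤ) + 1 = t + 1)] at ih'
    rw [invPoch_eq hq0 hq (by ring : (N : ℤ) - s - (t + 1) + 1 = N - s - t),
      invPoch_eq hq0 hq (by ring : (N : ℤ) - (t + 1) - r + 1 = N - t - r)]
    have e5 : (N : ℤ) - t - r = N - r - t := by ring
    rw [e5] at ih' ⊢
    linear_combination tel +
      (1 - q ^ ((N : ℤ) - r - t)) * (1 - q ^ ((N : ℤ) - s - t)) * ih'

end Summations

/-! ### Decoupling the cyclic products by a diagonal index. -/

section CyclicSums

variable {K : Type*} [Field K] {q : K}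

theorem sum_shift_two {j R : ℕ} (hj : j ≤ R) (H : ℤ → ℤ → K)
    (hz : ∀ r s : ℕ, j ≤ r → R ≤ r ∨ R ≤ s → H r s = 0) :
    ∑ r ∈ Finset.range R, ∑ s ∈ Finset.range R,
      invPoch q ((r : ℤ) - j) * (invPoch q ((s : ℤ) - j) * H r s) =
    ∑ a ∈ Finset.range R, ∑ b ∈ Finset.range R,
      invPoch q a * (invPoch q b * H (a + j) (b + j)) := by
  simp only [← Finset.mul_sum]
  rw [sum_shift j R (fun r => ∑ s ∈ Finset.range R, invPoch q ((s : ℤ) - j) * H r s)]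
  · apply Finset.sum_congr rfl
    intro a _
    congr 1
    apply sum_shift
    intro k hk
    have := hz (a + j) k (by omega) (Or.inr hk)
    push_cast at this
    exact this
  · intro k hk
    apply Finset.sum_eq_zero
    intro s _
    rw [hz k s (by omega) (Or.inl hk), mul_zero]

theorem sum_shift_three {j R : ℕ} (hj : j ≤ R) (H : ℤ → ℤ → ℤ → K)
    (hz : ∀ r s t : ℕ, j ≤ r → j ≤ s → j ≤ t → R ≤ r ∨ R ≤ s ∨ R ≤ t → H r s t = 0) :
    ∑ r ∈ Finset.range R, ∑ s ∈ Finset.range R, ∑ t ∈ Finset.range R,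
      invPoch q ((r : ℤ) - j) * (invPoch q ((s : ℤ) - j) * (invPoch q ((t : ℤ) - j) * H r s t)) =
    ∑ a ∈ Finset.range R, ∑ b ∈ Finset.range R, ∑ d ∈ Finset.range R,
      invPoch q a * (invPoch q b * (invPoch q d * H (a + j) (b + j) (d + j))) := by
  simp only [← Finset.mul_sum]
  have inner : ∀ r : ℕ, j ≤ r →
      ∑ s ∈ Finset.range R, invPoch q ((s : ℤ) - j) *
        ∑ t ∈ Finset.range R, invPoch q ((t : ℤ) - j) * H r s t =
      ∑ b ∈ Finset.range R, invPoch q b *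
        ∑ d ∈ Finset.range R, invPoch q d * H r (b + j) (d + j) := by
    intro r hr
    rw [sum_shift j R (fun s => ∑ t ∈ Finset.range R, invPoch q ((t : ℤ) - j) * H r s t)]
    · apply Finset.sum_congr rfl
      intro b _
      congr 1
      apply sum_shift
      intro k hk
      have := hz r (b + j) k hr (by omega) (by omega) (Or.inr (Or.inr hk))
      push_cast at this
      exact this
    · intro k hk
      apply Finset.sum_eq_zero
      intro t _
      rcases lt_or_ge t j with ht | ht
      · rw [invPoch_of_neg (by omega : (t : ℤ) - j < 0), zero_mul]
      · rw [hz r k t hr (by omega) ht (Or.inr (Or.inl hk)), mul_zero]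
  rw [sum_shift j R (fun r => ∑ s ∈ Finset.range R, invPoch q ((s : ℤ) - j) *
        ∑ t ∈ Finset.range R, invPoch q ((t : ℤ) - j) * H r s t)]
  · apply Finset.sum_congr rfl
    intro a _
    congr 1
    have := inner (a + j) (by omega)
    push_cast at this
    exact this
  · intro k hk
    apply Finset.sum_eq_zero
    intro s _
    rcases lt_or_ge s j with hs | hs
    · rw [invPoch_of_neg (by omega : (s : ℤ) - j < 0), zero_mul]
    · rw [Finset.sum_eq_zero, mul_zero]
      intro t _
      rcases lt_or_ge t j with ht | ht
      · rw [invPoch_of_neg (by omega : (t : ℤ) - j < 0), zero_mul]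
      · rw [hz k s t (by omega) hs ht (Or.inl hk), mul_zero]

theorem sum_comm_three (s : Finset ℕ) (F : ℕ → ℕ → ℕ → K) :
    ∑ r ∈ s, ∑ t ∈ s, ∑ j ∈ s, F r t j = ∑ j ∈ s, ∑ r ∈ s, ∑ t ∈ s, F r t j :=
  (Finset.sum_congr rfl fun _ _ => Finset.sum_comm).trans Finset.sum_comm

theorem sum_comm_four (s : Finset ℕ) (F : ℕ → ℕ → ℕ → ℕ → K) :
    ∑ r ∈ s, ∑ t ∈ s, ∑ u ∈ s, ∑ j ∈ s, F r t u j =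
      ∑ j ∈ s, ∑ r ∈ s, ∑ t ∈ s, ∑ u ∈ s, F r t u j :=
  (Finset.sum_congr rfl fun _ _ => sum_comm_three s _).trans Finset.sum_comm

/-- The cyclic double sum attached to `[N - r, s] [N - s, r]`. -/
def cyclicTwo (q : K) (N : ℕ) (n : ℤ) : K :=
  ∑ r ∈ Finset.range (N + 1), ∑ s ∈ Finset.range (N + 1),
    sgnTri q r * qPoch (-q) q (n - r) * qBinom q (N - r) s *
      (sgnTri q s * qPoch (-q) q (n - s) * qBinom q (N - s) r)

/-- The cyclic triple sum attached to `[N - r, s] [N - s, t] [N - t, r]`. -/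
def cyclicThree (q : K) (N : ℕ) (n : ℤ) : K :=
  ∑ r ∈ Finset.range (N + 1), ∑ s ∈ Finset.range (N + 1), ∑ t ∈ Finset.range (N + 1),
    sgnTri q r * qPoch (-q) q (n - r) * qBinom q (N - r) s *
      (sgnTri q s * qPoch (-q) q (n - s) * qBinom q (N - s) t) *
      (sgnTri q t * qPoch (-q) q (n - t) * qBinom q (N - t) r)

theorem sum_piFinset_two (s : Finset ℕ) (f : (Fin 2 → ℕ) → K) :
    ∑ r ∈ Fintype.piFinset (fun _ : Fin 2 => s), f r = ∑ a ∈ s, ∑ b ∈ s, f ![a, b] := by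
  rw [← Finset.sum_product']
  refine Finset.sum_nbij' (fun r => (r 0, r 1)) (fun x => ![x.1, x.2]) ?_ ?_ ?_ ?_ ?_
  · intro r hr
    rw [Fintype.mem_piFinset] at hr
    exact Finset.mem_product.2 ⟨hr 0, hr 1⟩
  · intro x hx
    rw [Finset.mem_product] at hx
    rw [Fintype.mem_piFinset]
    intro i
    fin_cases i
    · exact hx.1
    · exact hx.2
  · intro r _
    ext i
    fin_cases i <;> rfl
  · intro x _
    rfl
  · intro r _
    congr 1
    ext i
    fin_cases i <;> rfl

theorem sum_piFinset_three (s : Finset ℕ) (f : (Fin 3 → ℕ) → K) :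
    ∑ r ∈ Fintype.piFinset (fun _ : Fin 3 => s), f r =
      ∑ a ∈ s, ∑ b ∈ s, ∑ c ∈ s, f ![a, b, c] := by
  simp_rw [← Finset.sum_product']
  refine Finset.sum_nbij' (fun r => (r 0, r 1, r 2)) (fun x => ![x.1, x.2.1, x.2.2]) ?_ ?_ ?_ ?_ ?_
  · intro r hr
    rw [Fintype.mem_piFinset] at hr
    exact Finset.mem_product.2 ⟨hr 0, Finset.mem_product.2 ⟨hr 1, hr 2⟩⟩
  · intro x hx
    rw [Finset.mem_product, Finset.mem_product] at hx
    rw [Fintype.mem_piFinset]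
    intro i
    fin_cases i
    · exact hx.1
    · exact hx.2.1
    · exact hx.2.2
  · intro r _
    ext i
    fin_cases i <;> rfl
  · intro x _
    rfl
  · intro r _
    congr 1
    ext i
    fin_cases i <;> rfl

theorem multiU_two (n : ℕ) : multiU q 2 n = cyclicTwo q (2 * n + 1) n := by
  unfold multiU cyclicTwo
  rw [sum_piFinset_two]
  apply Finset.sum_congr rfl
  intro r _
  apply Finset.sum_congr rfl
  intro s _
  rw [Fin.prod_univ_two, sgnTri_natCast, sgnTri_natCast]
  have e1 : 2 * (n : ℤ) - r + 1 = ((2 * n + 1 : ℕ) : ℤ) - r := by push_cast; ring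
  have e2 : 2 * (n : ℤ) - s + 1 = ((2 * n + 1 : ℕ) : ℤ) - s := by push_cast; ring
  rw [← e1, ← e2]
  rfl

theorem multiW_two (n : ℕ) : multiW q 2 n = cyclicTwo q (2 * n) n := by
  unfold multiW cyclicTwo
  rw [sum_piFinset_two]
  apply Finset.sum_congr rfl
  intro r _
  apply Finset.sum_congr rfl
  intro s _
  rw [Fin.prod_univ_two, sgnTri_natCast, sgnTri_natCast]
  push_cast
  rfl

theorem multiU_three (n : ℕ) : multiU q 3 n = cyclicThree q (2 * n + 1) n := by
  unfold multiU cyclicThree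
  rw [sum_piFinset_three]
  apply Finset.sum_congr rfl
  intro r _
  apply Finset.sum_congr rfl
  intro s _
  apply Finset.sum_congr rfl
  intro t _
  rw [Fin.prod_univ_three, sgnTri_natCast, sgnTri_natCast, sgnTri_natCast]
  have e : ∀ x : ℕ, ((2 * n + 1 : ℕ) : ℤ) - x = 2 * (n : ℤ) - x + 1 := by
    intro x; push_cast; ring
  rw [e, e, e]
  rfl

theorem multiW_three (n : ℕ) : multiW q 3 n = cyclicThree q (2 * n) n := by
  unfold multiW cyclicThree
  rw [sum_piFinset_three]
  apply Finset.sum_congr rfl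
  intro r _
  apply Finset.sum_congr rfl
  intro s _
  apply Finset.sum_congr rfl
  intro t _
  rw [Fin.prod_univ_three, sgnTri_natCast, sgnTri_natCast, sgnTri_natCast]
  push_cast
  rfl

/-- The multinomial double sum left after diagonalising `cyclicTwo`. -/
def multiTwo (q : K) (R : ℕ) (M m : ℤ) : K :=
  ∑ a ∈ Finset.range R, ∑ b ∈ Finset.range R,
    invPoch q a * (invPoch q b * (sgnTri q a * sgnTri q b * qPoch (-q) q (m - a) *
      qPoch (-q) q (m - b) * invPoch q (M - a - b)))

/-- The multinomial triple sum left after diagonalising `cyclicThree`. -/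
def multiThree (q : K) (R : ℕ) (M m : ℤ) : K :=
  ∑ a ∈ Finset.range R, ∑ b ∈ Finset.range R, ∑ d ∈ Finset.range R,
    invPoch q a * (invPoch q b * (invPoch q d * (sgnTri q a * sgnTri q b * sgnTri q d *
      qPoch (-q) q (m - a) * qPoch (-q) q (m - b) * qPoch (-q) q (m - d) *
      invPoch q (M - a - b - d))))

/-- Vandermonde with y = 1 expands the product over j; after r = a + j, s = b + j, the cross factors
q^(aj) q^(bj) from the signed weights cancel those of the Vandermonde term. -/
theorem cyclicTwo_eq (hq0 : q ≠ 0) (hq : ∀ j : ℕ, 0 < j → q ^ j ≠ 1) (N : ℕ) (n : ℤ) :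
    cyclicTwo q N n = ∑ j ∈ Finset.range (N + 1),
      (-1) ^ j * q ^ (tri (j + 1) + (N - 2 * j) * j) * qPoch q q (N - j) * invPoch q j *
        sgnTri q j ^ 2 * multiTwo q (N + 1) (N - 2 * j) (n - j) := by
  have h1 : cyclicTwo q N n = ∑ r ∈ Finset.range (N + 1), ∑ s ∈ Finset.range (N + 1),
      ∑ j ∈ Finset.range (N + 1), sgnTri q r * qPoch (-q) q (n - r) * (sgnTri q s *
        qPoch (-q) q (n - s)) * invPoch q (N - r - s) * vandTerm q 1 (qPoch q q) N s r j := by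
    apply Finset.sum_congr rfl
    intro r hr
    apply Finset.sum_congr rfl
    intro s hs
    simp only [Finset.mem_range] at hr hs
    rw [qBinom_eq (by omega), qBinom_eq (by omega), ← Finset.mul_sum]
    have e : (N : ℤ) - s - r = N - r - s := by ring
    rw [e]
    -- The two binomials carry 1/(q;q)_{N-r-s} twice; one copy cancels against the factor
    -- (q;q)_{N-r-s} of Vandermonde, the other stays in the sum.
    by_cases h : (N : ℤ) - r - s < 0
    · rw [invPoch_of_neg h]; ring
    · have v := sum_vandermonde hq0 hq 1 (qPoch q q) (N := N) (r := r) (s := s) hr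
        (fun k hk => by rw [one_mul]; exact qPoch_self_add_one hq0 (by omega))
        (fun k hk => by rw [one_mul]; exact one_sub_zpow_ne_zero hq (by omega))
      have pg := qPoch_mul_invPoch hq0 hq (not_lt.1 h)
      linear_combination (-sgnTri q (r : ℤ) * qPoch (-q) q (n - r) * sgnTri q (s : ℤ) *
        qPoch (-q) q (n - s) * invPoch q ((N : ℤ) - r - s)) *
        (invPoch q ((N : ℤ) - r - s) * v - pg * ∑ j ∈ Finset.range (N + 1),
          vandTerm q 1 (qPoch q q) N s r j)
  rw [h1]
  rw [sum_comm_three]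
  apply Finset.sum_congr rfl
  intro j hj
  simp only [Finset.mem_range] at hj
  have h3 := sum_shift_two (q := q) (j := j) (R := N + 1) (by omega) (fun r s =>
    sgnTri q r * qPoch (-q) q (n - r) * (sgnTri q s * qPoch (-q) q (n - s)) *
      invPoch q (N - r - s) * ((-1) ^ j * q ^ (tri (j + 1) + (N - r - s) * j) * qPoch q q (N - j) *
      invPoch q j)) (by
    intro r s _ h
    rw [invPoch_of_neg (by omega : (N : ℤ) - r - s < 0)]
    ring)
  have h4 : ∑ r ∈ Finset.range (N + 1), ∑ s ∈ Finset.range (N + 1),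
      sgnTri q r * qPoch (-q) q (n - r) * (sgnTri q s * qPoch (-q) q (n - s)) *
        invPoch q (N - r - s) * vandTerm q 1 (qPoch q q) N s r j = _ := Eq.trans (by
    apply Finset.sum_congr rfl
    intro r _
    apply Finset.sum_congr rfl
    intro s _
    unfold vandTerm
    ring) h3
  rw [h4]
  unfold multiTwo
  simp only [Finset.mul_sum]
  apply Finset.sum_congr rfl
  intro a _
  apply Finset.sum_congr rfl
  intro b _
  rw [sgnTri_add hq0, sgnTri_add hq0]
  have e1 : tri ((j : ℤ) + 1) + (N - (a + j) - (b + j)) * j =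
    tri ((j : ℤ) + 1) + (N - 2 * j) * j - a * j - b * j := by ring
  have e2 : (N : ℤ) - (a + j) - (b + j) = N - 2 * j - a - b := by ring
  have e3 : n - ((a : ℤ) + j) = n - j - a := by ring
  have e4 : n - ((b : ℤ) + j) = n - j - b := by ring
  have e5 : q ^ (tri ((j : ℤ) + 1) + (N - 2 * j) * j) =
      q ^ (tri ((j : ℤ) + 1) + (N - 2 * j) * j - a * j - b * j) * q ^ ((a : ℤ) * j) *
        q ^ ((b : ℤ) * j) := by
    rw [← zpow_add₀ hq0, ← zpow_add₀ hq0]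
    congr 1; ring
  rw [e1, e2, e3, e4, e5]
  ring

/-- The product of the three binomials is exactly the symmetric right side of Saalschütz. After
shifting by j, the coupling 1/(q;q)_{N+j-r-s-t} becomes multinomial and the cross powers of q
cancel. -/
theorem cyclicThree_eq (hq0 : q ≠ 0) (hq : ∀ j : ℕ, 0 < j → q ^ j ≠ 1) (N : ℕ) (n : ℤ) :
    cyclicThree q N n = ∑ j ∈ Finset.range (N + 1),
      q ^ ((N - 2 * j) * j : ℤ) * qPoch q q (N - j) * invPoch q j *
        sgnTri q j ^ 3 * multiThree q (N + 1) (N - 2 * j) (n - j) := by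
  have h1 : cyclicThree q N n = ∑ r ∈ Finset.range (N + 1), ∑ s ∈ Finset.range (N + 1),
      ∑ t ∈ Finset.range (N + 1), ∑ j ∈ Finset.range (N + 1),
        sgnTri q r * qPoch (-q) q (n - r) * (sgnTri q s * qPoch (-q) q (n - s)) *
          (sgnTri q t * qPoch (-q) q (n - t)) * saalTerm q N r s t j := by
    apply Finset.sum_congr rfl
    intro r hr
    apply Finset.sum_congr rfl
    intro s hs
    apply Finset.sum_congr rfl
    intro t ht
    simp only [Finset.mem_range] at hr hs ht
    rw [qBinom_eq (by omega), qBinom_eq (by omega), qBinom_eq (by omega), ← Finset.mul_sum,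
      sum_saalschutz hq0 hq (by omega) (by omega) (by omega) (by omega)]
    ring
  rw [h1, sum_comm_four]
  apply Finset.sum_congr rfl
  intro j hj
  simp only [Finset.mem_range] at hj
  have h3 := sum_shift_three (q := q) (j := j) (R := N + 1) (by omega) (fun r s t =>
    sgnTri q r * qPoch (-q) q (n - r) * (sgnTri q s * qPoch (-q) q (n - s)) *
      (sgnTri q t * qPoch (-q) q (n - t)) * (q ^ (j * j + (N - r - s - t) * j) *
      qPoch q q (N - j) * invPoch q j * invPoch q (N + j - r - s - t))) (by
    intro r s t _ _ _ h
    rw [invPoch_of_neg (by omega : (N : ℤ) + j - r - s - t < 0)]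
    ring)
  have h4 : ∑ r ∈ Finset.range (N + 1), ∑ s ∈ Finset.range (N + 1),
      ∑ t ∈ Finset.range (N + 1),
        sgnTri q r * qPoch (-q) q (n - r) * (sgnTri q s * qPoch (-q) q (n - s)) *
          (sgnTri q t * qPoch (-q) q (n - t)) * saalTerm q N r s t j = _ := Eq.trans (by
    apply Finset.sum_congr rfl
    intro r _
    apply Finset.sum_congr rfl
    intro s _
    apply Finset.sum_congr rfl
    intro t _
    unfold saalTerm
    ring) h3
  rw [h4]
  unfold multiThree
  simp only [Finset.mul_sum]
  apply Finset.sum_congr rfl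
  intro a _
  apply Finset.sum_congr rfl
  intro b _
  apply Finset.sum_congr rfl
  intro d _
  rw [sgnTri_add hq0, sgnTri_add hq0, sgnTri_add hq0]
  have e1 : (j : ℤ) * j + (N - (a + j) - (b + j) - (d + j)) * j =
    (N - 2 * j) * j - a * j - b * j - d * j := by ring
  have e2 : (N : ℤ) + j - (a + j) - (b + j) - (d + j) = N - 2 * j - a - b - d := by ring
  have e3 : n - ((a : ℤ) + j) = n - j - a := by ring
  have e4 : n - ((b : ℤ) + j) = n - j - b := by ring
  have e6 : n - ((d : ℤ) + j) = n - j - d := by ring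
  have e5 : q ^ (((N : ℤ) - 2 * j) * j) = q ^ (((N : ℤ) - 2 * j) * j - a * j - b * j - d * j) *
      q ^ ((a : ℤ) * j) * q ^ ((b : ℤ) * j) * q ^ ((d : ℤ) * j) := by
    rw [← zpow_add₀ hq0, ← zpow_add₀ hq0, ← zpow_add₀ hq0]
    congr 1; ring
  rw [e1, e2, e3, e4, e5, e6]
  ring

end CyclicSums

/-! ### Reflection and the evaluation of the double sums. -/

section Evaluations

variable {K : Type*} [Field K] {q : K}

theorem neg_one_zpow_sq (k : ℤ) : ((-1 : K) ^ k) ^ 2 = 1 := by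
  rw [← zpow_natCast, ← zpow_mul, mul_comm, zpow_mul]
  simp

theorem sgnTri_sq (k : ℤ) : sgnTri q k ^ 2 = q ^ (2 * tri k) := by
  unfold sgnTri
  rw [mul_pow, neg_one_zpow_sq, one_mul, mul_comm 2, zpow_mul]
  exact (zpow_natCast (q ^ tri k) 2).symm

theorem altSum_qPoch_neg (h2 : (2 : K) ≠ 0) (hq0 : q ≠ 0) (hq : ∀ j : ℕ, 0 < j → q ^ j ≠ 1)
    {R : ℕ} (hR0 : 0 < R) {L m : ℤ} (hR : L < R) :
    altSum q R (fun a => qPoch (-q) q (m - a)) L =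
      invPoch q L * (q ^ (L * m - tri L) * qPoch (-q) q (m - L)) := by
  rw [altSum_poch hq0 hq (-1) (qPoch (-q) q) hR0 hR]
  · simp
  · intro k _
    rw [qPoch_neg_add_one h2 hq0 hq]
    ring

/-- The sum produces (-q;q)_{-(m+1-u)}, the reflection partner of (-q;q)_{m-u}. The resulting power
of q does not depend on u. -/
theorem altSum_mul_odd (h2 : (2 : K) ≠ 0) (hq0 : q ≠ 0) (hq : ∀ j : ℕ, 0 < j → q ^ j ≠ 1)
    {R : ℕ} (hR0 : 0 < R) {M m u : ℤ} (hR : M - u < R) (hM : M = 2 * m + 1) :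
    altSum q R (fun a => qPoch (-q) q (m - a)) (M - u) * qPoch (-q) q (m - u) =
      q ^ tri (m + 1) / 2 * invPoch q (M - u) := by
  rw [altSum_qPoch_neg h2 hq0 hq hR0 hR]
  have r := qPoch_neg_reflect h2 hq0 hq (m + 1 - u)
  have e1 : m + 1 - u - 1 = m - u := by ring
  have e2 : m - (M - u) = -(m + 1 - u) := by rw [hM]; ring
  have e3 : q ^ tri (m + 1) = q ^ ((M - u) * m - tri (M - u)) * q ^ tri (m + 1 - u) := by
    rw [← zpow_add₀ hq0]
    congr 1
    have t1 := two_mul_tri (m + 1)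
    have t2 := two_mul_tri (M - u)
    have t3 := two_mul_tri (m + 1 - u)
    subst hM
    linarith
  rw [e1] at r
  rw [e2, e3]
  linear_combination invPoch q (M - u) * q ^ ((M - u) * m - tri (M - u)) * r

/-- Here the indices miss a reflection pair by one; stripping one factor from (-q;q)_{m-u} leaves 1
+ q^(m-u). -/
theorem altSum_mul_even (h2 : (2 : K) ≠ 0) (hq0 : q ≠ 0) (hq : ∀ j : ℕ, 0 < j → q ^ j ≠ 1)
    {R : ℕ} (hR0 : 0 < R) {M m u : ℤ} (hR : M - u < R) (hM : M = 2 * m) :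
    altSum q R (fun a => qPoch (-q) q (m - a)) (M - u) * qPoch (-q) q (m - u) =
      q ^ tri (m + 1) / 2 * invPoch q (M - u) * (1 + q ^ (m - u)) := by
  rw [altSum_qPoch_neg h2 hq0 hq hR0 hR]
  have r := qPoch_neg_reflect h2 hq0 hq (m - u)
  have s := qPoch_neg_add_one h2 hq0 hq (m - u - 1)
  have e1 : m - u - 1 + 1 = m - u := by ring
  have e2 : m - (M - u) = -(m - u) := by rw [hM]; ring
  have e3 : q ^ tri (m + 1) = q ^ ((M - u) * m - tri (M - u)) * q ^ tri (m - u) := by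
    rw [← zpow_add₀ hq0]
    congr 1
    have t1 := two_mul_tri (m + 1)
    have t2 := two_mul_tri (M - u)
    have t3 := two_mul_tri (m - u)
    subst hM
    linarith
  rw [e1] at s
  rw [e2, e3, s]
  linear_combination (invPoch q (M - u) * q ^ ((M - u) * m - tri (M - u))) *
    (1 + q ^ (m - u)) * r

theorem multiTwo_eq_sum (R : ℕ) (M m : ℤ) : multiTwo q R M m = ∑ a ∈ Finset.range R,
    invPoch q a * (sgnTri q a *
      (altSum q R (fun b => qPoch (-q) q (m - b)) (M - a) * qPoch (-q) q (m - a))) := by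
  unfold multiTwo altSum
  apply Finset.sum_congr rfl
  intro a _
  rw [Finset.sum_mul, Finset.mul_sum, Finset.mul_sum]
  apply Finset.sum_congr rfl
  intro b _
  ring

theorem multiTwo_odd (h2 : (2 : K) ≠ 0) (hq0 : q ≠ 0) (hq : ∀ j : ℕ, 0 < j → q ^ j ≠ 1)
    {R : ℕ} (hR0 : 0 < R) {M m : ℤ} (hR : M < R) (hM : M = 2 * m + 1) :
    multiTwo q R M m = 0 := by
  have h : multiTwo q R M m = q ^ tri (m + 1) / 2 * altSum q R (fun _ => 1) M := by
    rw [multiTwo_eq_sum]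
    unfold altSum
    rw [Finset.mul_sum]
    apply Finset.sum_congr rfl
    intro a _
    have := altSum_mul_odd h2 hq0 hq hR0 (by omega : M - (a : ℤ) < R) hM
    unfold altSum at this
    rw [this]
    ring
  rw [h, altSum_one hq0 hq hR0 hR, if_neg (by omega), mul_zero]

/-- The factor 1 + q^(m-a) leaves the sums of `altSum_one` and `altSum_zpow_neg`. Since M is even,
only M = 0 contributes, where two terms cancel the 1/2. -/
theorem multiTwo_even (h2 : (2 : K) ≠ 0) (hq0 : q ≠ 0) (hq : ∀ j : ℕ, 0 < j → q ^ j ≠ 1)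
    {R : ℕ} (hR0 : 0 < R) {M m : ℤ} (hR : M < R) (hM : M = 2 * m) :
    multiTwo q R M m = if m = 0 then 1 else 0 := by
  have h : multiTwo q R M m = q ^ tri (m + 1) / 2 * (altSum q R (fun _ => 1) M +
      q ^ m * altSum q R (fun a => q ^ (-a)) M) := by
    rw [multiTwo_eq_sum]
    unfold altSum
    rw [Finset.mul_sum, ← Finset.sum_add_distrib, Finset.mul_sum]
    apply Finset.sum_congr rfl
    intro a _
    have := altSum_mul_even h2 hq0 hq hR0 (by omega : M - (a : ℤ) < R) hM
    unfold altSum at this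
    rw [this, sub_eq_add_neg m, zpow_add₀ hq0]
    ring
  rw [h, altSum_one hq0 hq hR0 hR, altSum_zpow_neg hq0 hq hR0 hR, if_neg (by omega : ¬ M = 1)]
  by_cases hm : m = 0
  · subst hm
    rw [if_pos (by omega), if_pos (by omega)]
    simp only [zero_add, tri_one, zpow_zero]
    field_simp
    norm_num
  · rw [if_neg (by omega), if_neg (by omega)]
    ring

theorem cyclicTwo_odd (h2 : (2 : K) ≠ 0) (hq0 : q ≠ 0) (hq : ∀ j : ℕ, 0 < j → q ^ j ≠ 1) (n : ℕ) :
    cyclicTwo q (2 * n + 1) n = 0 := by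
  rw [cyclicTwo_eq hq0 hq]
  apply Finset.sum_eq_zero
  intro j _
  rw [multiTwo_odd h2 hq0 hq (by omega) (by push_cast; omega) (by push_cast; ring), mul_zero]

theorem cyclicTwo_even (h2 : (2 : K) ≠ 0) (hq0 : q ≠ 0) (hq : ∀ j : ℕ, 0 < j → q ^ j ≠ 1)
    (n : ℕ) : cyclicTwo q (2 * n) n = (-1) ^ n * q ^ ((n : ℤ) * (3 * n - 1) / 2) := by
  rw [cyclicTwo_eq hq0 hq, Finset.sum_eq_single n]
  · rw [multiTwo_even h2 hq0 hq (by omega) (by push_cast; omega) (by push_cast; ring),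
      if_pos (by ring)]
    have pg := qPoch_mul_invPoch hq0 hq (by omega : 0 ≤ (n : ℤ))
    have e1 : ((2 * n : ℕ) : ℤ) - n = n := by push_cast; ring
    have e2 : ((2 * n : ℕ) : ℤ) - 2 * n = 0 := by push_cast; ring
    have e3 : (n : ℤ) * (3 * n - 1) / 2 = tri (n + 1) + 2 * tri n := by
      have t1 := two_mul_tri (n + 1)
      have t2 := two_mul_tri n
      have : (n : ℤ) * (3 * n - 1) = 2 * (tri (n + 1) + 2 * tri n) := by linarith
      rw [this, Int.mul_ediv_cancel_left _ two_ne_zero]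
    rw [e1, e2, e3, sgnTri_sq, zero_mul, add_zero, zpow_add₀ hq0]
    linear_combination ((-1) ^ n * q ^ (tri ((n : ℤ) + 1)) * q ^ (2 * tri n)) * pg
  · intro j _ hj
    rw [multiTwo_even h2 hq0 hq (by omega) (by push_cast; omega) (by push_cast; ring),
      if_neg (by omega), mul_zero]
  · intro h
    simp at h; omega

end Evaluations

/-! ### Reducing the triple multinomial sum to a single sum. -/

section TripleSum

variable {K : Type*} [Field K] {q : K}

theorem sum_invPoch_mul_ite {R : ℕ} {L : ℤ} (hL : L < R) (F : ℤ → K) :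
    ∑ b ∈ Finset.range R, invPoch q b * (F b * if L - b = 0 then 1 else 0) =
      invPoch q L * F L := by
  rcases lt_or_ge L 0 with h | h
  · rw [invPoch_of_neg h, zero_mul]
    apply Finset.sum_eq_zero
    intro b _
    rw [if_neg (by omega)]
    ring
  · obtain ⟨n, rfl⟩ := Int.eq_ofNat_of_zero_le h
    rw [Finset.sum_eq_single n]
    · rw [if_pos (by ring), mul_one]
    · intro b _ hb
      rw [if_neg (by omega)]
      ring
    · intro hn
      simp at hn; omega

/-- The `q`-trinomial double sum with weight `f(a + b)`. -/
def trinomialSum (q : K) (R : ℕ) (f : ℤ → K) (L : ℤ) : K :=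
  ∑ a ∈ Finset.range R, ∑ b ∈ Finset.range R,
    invPoch q a * (invPoch q b * (sgnTri q a * sgnTri q b * invPoch q (L - a - b) * f (a + b)))

theorem trinomialSum_one (hq0 : q ≠ 0) (hq : ∀ j : ℕ, 0 < j → q ^ j ≠ 1) {R : ℕ} (hR0 : 0 < R)
    {L : ℤ} (hL : L < R) : trinomialSum q R (fun _ => 1) L = invPoch q L * sgnTri q L := by
  rw [← sum_invPoch_mul_ite hL]
  unfold trinomialSum
  apply Finset.sum_congr rfl
  intro a _
  rw [← altSum_one hq0 hq hR0 (by omega : L - (a : ℤ) < R)]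
  unfold altSum
  rw [Finset.mul_sum, Finset.mul_sum]
  apply Finset.sum_congr rfl
  intro b _
  ring

/-- By `altSum_zpow_neg` the sum over b is supported on a = L and a = L - 1, giving the two
summands. -/
theorem trinomialSum_zpow_neg (hq0 : q ≠ 0) (hq : ∀ j : ℕ, 0 < j → q ^ j ≠ 1) {R : ℕ}
    (hR0 : 0 < R) {L : ℤ} (hL : L < R) : trinomialSum q R (fun a => q ^ (-a)) L =
      invPoch q L * sgnTri q L * (q ^ (-L) + q ^ (1 - 2 * L) * (1 - q ^ L)) := by
  have h : trinomialSum q R (fun a => q ^ (-a)) L =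
      invPoch q L * (sgnTri q L * q ^ (-L)) +
        invPoch q (L - 1) * (sgnTri q (L - 1) * q ^ (-(L - 1)) * -q⁻¹) := by
    rw [← sum_invPoch_mul_ite hL (fun b => sgnTri q b * q ^ (-b)),
      ← sum_invPoch_mul_ite (by omega : L - 1 < R) (fun b => sgnTri q b * q ^ (-b) * -q⁻¹),
      ← Finset.sum_add_distrib]
    unfold trinomialSum
    apply Finset.sum_congr rfl
    intro a _
    have e := altSum_zpow_neg hq0 hq hR0 (by omega : L - (a : ℤ) < R)
    have e' : (if L - (a : ℤ) = 0 then (1 : K) else if L - (a : ℤ) = 1 then -q⁻¹ else 0) =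
        (if L - (a : ℤ) = 0 then 1 else 0) + -q⁻¹ * (if L - 1 - (a : ℤ) = 0 then 1 else 0) := by
      by_cases h0 : L - (a : ℤ) = 0
      · rw [if_pos h0, if_pos h0, if_neg (by omega)]; ring
      · by_cases h1 : L - (a : ℤ) = 1
        · rw [if_neg h0, if_pos h1, if_neg h0, if_pos (by omega)]; ring
        · rw [if_neg h0, if_neg h1, if_neg h0, if_neg (by omega)]; ring
    rw [e'] at e
    have e3 : ∀ X Y : K, invPoch q a * (sgnTri q a * q ^ (-(a : ℤ)) * X) +
        invPoch q a * (sgnTri q a * q ^ (-(a : ℤ)) * -q⁻¹ * Y) =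
        invPoch q a * (sgnTri q a * q ^ (-(a : ℤ))) * (X + -q⁻¹ * Y) := by intros; ring
    rw [e3, ← e]
    unfold altSum
    rw [Finset.mul_sum]
    apply Finset.sum_congr rfl
    intro b _
    simp only [neg_add, zpow_add₀ hq0]
    ring
  rw [h, invPoch_sub_one hq0 hq]
  have hw := sgnTri_succ hq0 (L - 1)
  rw [sub_add_cancel] at hw
  rw [hw]
  have e1 : q ^ (L - 1) = q ^ L * q⁻¹ := by
    rw [zpow_sub₀ hq0, zpow_one, div_eq_mul_inv]
  have e2 : q ^ (-(L - 1)) = (q ^ L)⁻¹ * q := by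
    rw [neg_sub, zpow_sub₀ hq0, zpow_one, div_eq_mul_inv, mul_comm]
  have e3 : q ^ (1 - 2 * L) = q * (q ^ L)⁻¹ * (q ^ L)⁻¹ := by
    rw [zpow_sub₀ hq0, zpow_one, two_mul, zpow_add₀ hq0, div_eq_mul_inv, mul_inv, mul_assoc]
  rw [e1, e2, e3, zpow_neg]
  have := zpow_ne_zero L hq0
  field_simp
  ring

/-- Summing out one index of `multiThree` when the convolution `altSum_mul_odd` or
`altSum_mul_even` supplies the factor `C * f`. -/
theorem multiThree_eq (h2 : (2 : K) ≠ 0) (hq0 : q ≠ 0) (hq : ∀ j : ℕ, 0 < j → q ^ j ≠ 1)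
    {R : ℕ} {M m : ℤ} (hR : M < R) (C : K) (f : ℤ → K)
    (hf : ∀ u : ℕ, altSum q R (fun a => qPoch (-q) q (m - a)) (M - u) * qPoch (-q) q (m - u) =
      C * invPoch q (M - u) * f u) :
    multiThree q R M m = C * ∑ i ∈ Finset.range R,
      q ^ (tri (i + 1) + (m - 2 * i) * i) * qPoch (-q) q (m - i) * invPoch q i * sgnTri q i ^ 2 *
        trinomialSum q R (fun a => f (a + 2 * i)) (M - 2 * i) := by
  have h1 : multiThree q R M m = ∑ b ∈ Finset.range R, ∑ d ∈ Finset.range R,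
      ∑ i ∈ Finset.range R, sgnTri q b * sgnTri q d * (C * invPoch q (M - b - d) * f (b + d)) *
        vandTerm q (-1) (qPoch (-q) q) m d b i := by
    unfold multiThree
    apply Finset.sum_congr rfl
    intro b hb
    apply Finset.sum_congr rfl
    intro d _
    simp only [Finset.mem_range] at hb
    -- Summing out x calls for the partner (-q;q)_{m-b-d}, while (-q;q)_{m-b} (-q;q)_{m-d} is
    -- present. Vandermonde with y = -1 supplies exactly that factor, at the cost of the index i.
    have v := sum_vandermonde hq0 hq (-1) (qPoch (-q) q) (N := m) (r := b) (s := d) hb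
      (fun k _ => by rw [qPoch_neg_add_one h2 hq0 hq]; ring)
      (fun k _ => by
        have := one_add_zpow_ne_zero h2 hq (k + 1)
        rwa [neg_one_mul, sub_neg_eq_add])
    have f' := hf (b + d)
    push_cast at f'
    have e1 : M - ((b : ℤ) + d) = M - b - d := by ring
    have e2 : m - ((b : ℤ) + d) = m - b - d := by ring
    rw [e1, e2] at f'
    have hL : ∑ x ∈ Finset.range R, invPoch q (b : ℤ) * (invPoch q (d : ℤ) * (invPoch q (x : ℤ) *
        (sgnTri q b * sgnTri q d * sgnTri q x * qPoch (-q) q (m - b) * qPoch (-q) q (m - d) *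
          qPoch (-q) q (m - x) * invPoch q (M - b - d - x)))) =
        (invPoch q (b : ℤ) * invPoch q (d : ℤ) * qPoch (-q) q (m - b) * qPoch (-q) q (m - d)) *
          (sgnTri q b * sgnTri q d * altSum q R (fun a => qPoch (-q) q (m - a)) (M - b - d)) := by
      unfold altSum
      rw [Finset.mul_sum, Finset.mul_sum]
      apply Finset.sum_congr rfl
      intro x _
      ring
    rw [hL, ← Finset.mul_sum]
    rw [← v, ← f']
    ring
  rw [h1, sum_comm_three, Finset.mul_sum]
  apply Finset.sum_congr rfl
  intro i hi
  simp only [Finset.mem_range] at hi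
  have h3 := sum_shift_two (q := q) (j := i) (R := R) hi.le (fun b d =>
    sgnTri q b * sgnTri q d * (C * invPoch q (M - b - d) * f (b + d)) *
      (q ^ (tri (i + 1) + (m - b - d) * i) * qPoch (-q) q (m - i) * invPoch q i)) (by
    intro r s _ h
    rw [invPoch_of_neg (by omega : M - r - s < 0)]
    ring)
  have h4 : ∑ b ∈ Finset.range R, ∑ d ∈ Finset.range R,
      sgnTri q b * sgnTri q d * (C * invPoch q (M - b - d) * f (b + d)) *
        vandTerm q (-1) (qPoch (-q) q) m d b i = _ := Eq.trans (by
    apply Finset.sum_congr rfl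
    intro r _
    apply Finset.sum_congr rfl
    intro s _
    unfold vandTerm
    rw [neg_neg, one_pow]
    ring) h3
  rw [h4]
  unfold trinomialSum
  simp only [Finset.mul_sum]
  apply Finset.sum_congr rfl
  intro a _
  apply Finset.sum_congr rfl
  intro b _
  rw [sgnTri_add hq0, sgnTri_add hq0]
  have e1 : tri ((i : ℤ) + 1) + (m - (a + i) - (b + i)) * i =
    tri ((i : ℤ) + 1) + (m - 2 * i) * i - a * i - b * i := by ring
  have e2 : M - ((a : ℤ) + i) - (b + i) = M - 2 * i - a - b := by ring
  have e3 : (a : ℤ) + i + (b + i) = a + b + 2 * i := by ring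
  have e5 : q ^ (tri ((i : ℤ) + 1) + (m - 2 * i) * i) =
      q ^ (tri ((i : ℤ) + 1) + (m - 2 * i) * i - a * i - b * i) * q ^ ((a : ℤ) * i) *
        q ^ ((b : ℤ) * i) := by
    rw [← zpow_add₀ hq0, ← zpow_add₀ hq0]
    congr 1; ring
  rw [e1, e2, e3, e5]
  ring

theorem multiThree_odd (h2 : (2 : K) ≠ 0) (hq0 : q ≠ 0) (hq : ∀ j : ℕ, 0 < j → q ^ j ≠ 1)
    {R : ℕ} (hR0 : 0 < R) {M m : ℤ} (hR : M < R) (hM : M = 2 * m + 1) :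
    multiThree q R M m = q ^ tri (m + 1) / 2 * ∑ i ∈ Finset.range R,
      q ^ (tri (i + 1) + (m - 2 * i) * i) * qPoch (-q) q (m - i) * invPoch q i * sgnTri q i ^ 2 *
        (invPoch q (M - 2 * i) * sgnTri q (M - 2 * i)) := by
  rw [multiThree_eq h2 hq0 hq hR (q ^ tri (m + 1) / 2) (fun _ => 1) (fun u => by
    rw [altSum_mul_odd h2 hq0 hq hR0 (by omega) hM, mul_one])]
  congr 1
  apply Finset.sum_congr rfl
  intro i _
  rw [trinomialSum_one hq0 hq hR0 (by omega)]

theorem multiThree_even (h2 : (2 : K) ≠ 0) (hq0 : q ≠ 0) (hq : ∀ j : ℕ, 0 < j → q ^ j ≠ 1)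
    {R : ℕ} (hR0 : 0 < R) {M m : ℤ} (hR : M < R) (hM : M = 2 * m) :
    multiThree q R M m = q ^ tri (m + 1) / 2 * ∑ i ∈ Finset.range R,
      q ^ (tri (i + 1) + (m - 2 * i) * i) * qPoch (-q) q (m - i) * invPoch q i * sgnTri q i ^ 2 *
        (invPoch q (M - 2 * i) * sgnTri q (M - 2 * i) * (1 + q ^ (m - 2 * i) *
          (q ^ (-(M - 2 * i)) + q ^ (1 - 2 * (M - 2 * i)) * (1 - q ^ (M - 2 * i))))) := by
  rw [multiThree_eq h2 hq0 hq hR (q ^ tri (m + 1) / 2) (fun u => 1 + q ^ (m - u)) (fun u => by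
    rw [altSum_mul_even h2 hq0 hq hR0 (by omega) hM])]
  congr 1
  apply Finset.sum_congr rfl
  intro i _
  congr 1
  have h1 := trinomialSum_one (q := q) hq0 hq hR0 (by omega : M - 2 * (i : ℤ) < R)
  have h2 := trinomialSum_zpow_neg (q := q) hq0 hq hR0 (by omega : M - 2 * (i : ℤ) < R)
  rw [mul_add, mul_one, mul_left_comm, ← h2, ← h1]
  unfold trinomialSum
  simp only [Finset.mul_sum]
  rw [← Finset.sum_add_distrib]
  apply Finset.sum_congr rfl
  intro a _
  rw [← Finset.sum_add_distrib]
  apply Finset.sum_congr rfl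
  intro b _
  have e : m - ((a : ℤ) + b + 2 * i) = (m - 2 * i) + -(a + b) := by ring
  rw [e, zpow_add₀ hq0]
  ring

end TripleSum

/-! ### Merging the diagonal indices: the triple cyclic sums in terms of `fibSum`. -/

section Reduction

variable {K : Type*} [Field K] {q : K}

/-- The summand `(-1)^u q^(u^2 - n u + x u) [N - u, u] (-q;q)_{n-u}`. -/
def fibTerm (q : K) (N n x u : ℤ) : K :=
  (-1) ^ u * q ^ (u * u - n * u + x * u) * qPoch q q (N - u) * invPoch q u *
    invPoch q (N - 2 * u) * qPoch (-q) q (n - u)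

/-- The single sum `∑_u (-1)^u q^(u^2 - n u + x u) [N - u, u] (-q;q)_{n-u}`. -/
def fibSum (q : K) (N : ℕ) (n x : ℤ) : K := ∑ u ∈ Finset.range (N + 1), fibTerm q N n x u

theorem fibTerm_of_lt {N n x u : ℤ} (h : N < 2 * u) : fibTerm q N n x u = 0 := by
  unfold fibTerm
  rw [invPoch_of_neg (by omega : N - 2 * u < 0)]
  ring

theorem fibSum_eq {N R : ℕ} (n x : ℤ) (hR : N < 2 * R) :
    fibSum q N n x = ∑ u ∈ Finset.range R, fibTerm q N n x u := by
  rcases le_total (N + 1) R with h | h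
  · refine Finset.sum_subset (Finset.range_mono h) fun u _ hu => fibTerm_of_lt ?_
    simp only [Finset.mem_range, not_lt] at hu
    omega
  · refine (Finset.sum_subset (Finset.range_mono h) fun u _ hu => fibTerm_of_lt ?_).symm
    simp only [Finset.mem_range, not_lt] at hu
    omega

theorem altSum_qPoch_self (hq0 : q ≠ 0) (hq : ∀ j : ℕ, 0 < j → q ^ j ≠ 1) {N u : ℕ} (hu : u ≤ N) :
    altSum q (N + 1) (fun a => qPoch q q (N - a)) u =
      invPoch q u * ((-1) ^ (u : ℤ) * q ^ (u * N - tri u) * qPoch q q (N - u)) := by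
  rw [altSum_poch hq0 hq 1 (qPoch q q) (by omega) (by omega), Int.toNat_natCast,
    zpow_natCast (-1 : K) u]
  intro k hk
  rw [one_mul]
  exact qPoch_self_add_one hq0 (by omega)

theorem altSum_zpow_neg_mul_qPoch_self (hq0 : q ≠ 0) (hq : ∀ j : ℕ, 0 < j → q ^ j ≠ 1) {N u : ℕ}
    (hu : u ≤ N) : altSum q (N + 1) (fun a => q ^ (-a) * qPoch q q (N - a)) u =
      invPoch q u * ((-1) ^ (u : ℤ) * q ^ (u * N - tri u) * qPoch q q (N - u)) *
        (1 + (1 - q ^ (u : ℤ)) * q ^ (-(N : ℤ) - 1)) := by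
  rw [altSum_zpow_neg_mul_poch hq0 hq (qPoch q q) (by omega) (by omega), Int.toNat_natCast,
    zpow_natCast (-1 : K) u]
  intro k hk
  exact qPoch_self_add_one hq0 (by omega)

/-- The exponent produced when the two diagonal indices are merged. -/
def mergeExp (n u : ℤ) : ℤ := 2 * tri u + tri (u + 1) + (n - 2 * u) * u + tri (n + 1)

/-- With u = i + j fixed all quadratic terms in j cancel. What is left is q^0 for N = 2n+1 and
q^(-j) for N = 2n, so the sum over j is a known `altSum`. -/
theorem merge_zpow (hq0 : q ≠ 0) (N n u j : ℤ) :
    q ^ ((N - 2 * j) * j) * q ^ tri (n - j + 1) *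
      q ^ (tri (u - j + 1) + (n - j - 2 * (u - j)) * (u - j)) * sgnTri q j ^ 2 *
        sgnTri q (u - j) ^ 2 = q ^ mergeExp n u * q ^ ((N - 2 * n - 1) * j) := by
  rw [sgnTri_sq, sgnTri_sq]
  simp only [← zpow_add₀ hq0]
  congr 1
  unfold mergeExp
  have t1 := two_mul_tri (n - j + 1)
  have t2 := two_mul_tri (u - j + 1)
  have t3 := two_mul_tri j
  have t4 := two_mul_tri (u - j)
  have t5 := two_mul_tri u
  have t6 := two_mul_tri (u + 1)
  have t7 := two_mul_tri (n + 1)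
  linarith

/-- Replacing the double sum over `(j, i)` by the sum over `u = i + j` and `j`. -/
theorem sum_merge (hq0 : q ≠ 0) (N : ℕ) (n : ℤ) (F : ℤ → ℤ → K) :
    ∑ j ∈ Finset.range (N + 1), q ^ ((N - 2 * j) * j : ℤ) * qPoch q q (N - j) * invPoch q j *
      sgnTri q j ^ 3 * (q ^ tri (n - j + 1) / 2 * ∑ i ∈ Finset.range (N + 1),
        q ^ (tri (i + 1) + (n - j - 2 * i) * i) * qPoch (-q) q (n - j - i) * invPoch q i *
          sgnTri q i ^ 2 * (invPoch q (N - 2 * j - 2 * i) * F (i + j) j)) =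
    ∑ u ∈ Finset.range (N + 1), q ^ mergeExp n u / 2 * qPoch (-q) q (n - u) *
      invPoch q (N - 2 * u) * altSum q (N + 1)
        (fun j => q ^ ((N - 2 * n - 1) * j) * F u j * qPoch q q (N - j)) u := by
  have h : ∀ j ∈ Finset.range (N + 1), q ^ ((N - 2 * j) * j : ℤ) * qPoch q q (N - j) *
      invPoch q j * sgnTri q j ^ 3 * (q ^ tri (n - j + 1) / 2 * ∑ i ∈ Finset.range (N + 1),
        q ^ (tri (i + 1) + (n - j - 2 * i) * i) * qPoch (-q) q (n - j - i) * invPoch q i *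
          sgnTri q i ^ 2 * (invPoch q (N - 2 * j - 2 * i) * F (i + j) j)) =
      ∑ u ∈ Finset.range (N + 1), q ^ mergeExp n u / 2 * qPoch (-q) q (n - u) *
        invPoch q (N - 2 * u) * (invPoch q j * (sgnTri q j * invPoch q (u - j) *
          (q ^ ((N - 2 * n - 1) * j) * F u j * qPoch q q (N - j)))) := by
    intro j _
    have s := sum_shift (q := q) j (N + 1) (fun u =>
      q ^ ((N - 2 * j) * j : ℤ) * qPoch q q (N - j) * invPoch q j * sgnTri q j ^ 3 *
        (q ^ tri (n - j + 1) / 2) * (q ^ (tri (u - j + 1) + (n - j - 2 * (u - j)) * (u - j)) *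
          qPoch (-q) q (n - u) * sgnTri q (u - j) ^ 2 * (invPoch q (N - 2 * u) * F u j))) (by
      intro k hk
      rw [invPoch_of_neg (by omega : (N : ℤ) - 2 * k < 0)]
      ring)
    rw [Finset.mul_sum, Finset.mul_sum]
    refine Eq.trans ?_ (s.symm.trans ?_)
    · apply Finset.sum_congr rfl
      intro i _
      have e1 : (i : ℤ) + j - j = i := by ring
      have e2 : n - ((i : ℤ) + j) = n - j - i := by ring
      have e3 : (N : ℤ) - 2 * ((i : ℤ) + j) = N - 2 * j - 2 * i := by ring
      rw [e1, e2, e3]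
      ring
    · apply Finset.sum_congr rfl
      intro u _
      have m := merge_zpow hq0 N n u j
      linear_combination (invPoch q ((u : ℤ) - j) * qPoch q q ((N : ℤ) - j) * invPoch q (j : ℤ) *
        sgnTri q j / 2 * qPoch (-q) q (n - u) * invPoch q ((N : ℤ) - 2 * u) * F u j) * m
  rw [Finset.sum_congr rfl h, Finset.sum_comm]
  apply Finset.sum_congr rfl
  intro u _
  unfold altSum
  rw [Finset.mul_sum]

theorem cyclicThree_odd_eq (h2 : (2 : K) ≠ 0) (hq0 : q ≠ 0) (hq : ∀ j : ℕ, 0 < j → q ^ j ≠ 1)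
    (n : ℕ) : cyclicThree q (2 * n + 1) n =
      -(q ^ (tri (n + 1) + tri (2 * n + 1)) / 2) * fibSum q (2 * n + 1) n 0 := by
  have hsgn : ∀ u : ℤ, sgnTri q (((2 * n + 1 : ℕ) : ℤ) - 2 * u) =
      -q ^ tri (2 * n + 1 - 2 * u) := by
    intro u
    unfold sgnTri
    have : ((2 * n + 1 : ℕ) : ℤ) - 2 * u = 2 * n + 1 - 2 * u := by push_cast; ring
    rw [this, Odd.neg_one_zpow ⟨n - u, by ring⟩]
    ring
  have h := sum_merge hq0 (2 * n + 1) n (fun u _ => sgnTri q (((2 * n + 1 : ℕ) : ℤ) - 2 * u))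
  rw [cyclicThree_eq hq0 hq]
  refine Eq.trans ?_ (h.trans ?_)
  · apply Finset.sum_congr rfl
    intro j _
    rw [multiThree_odd h2 hq0 hq (by omega) (by push_cast; omega) (by push_cast; ring)]
    congr 2
    apply Finset.sum_congr rfl
    intro i _
    have e : ((2 * n + 1 : ℕ) : ℤ) - 2 * ((i : ℤ) + j) = ((2 * n + 1 : ℕ) : ℤ) - 2 * j - 2 * i := by
      ring
    rw [e]
  · unfold fibSum
    rw [Finset.mul_sum]
    apply Finset.sum_congr rfl
    intro u hu
    simp only [Finset.mem_range] at hu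
    have e1 : (fun j : ℤ => q ^ ((((2 * n + 1 : ℕ) : ℤ) - 2 * n - 1) * j) *
        sgnTri q (((2 * n + 1 : ℕ) : ℤ) - 2 * u) * qPoch q q (((2 * n + 1 : ℕ) : ℤ) - j)) =
        fun j : ℤ => sgnTri q (((2 * n + 1 : ℕ) : ℤ) - 2 * u) *
          qPoch q q (((2 * n + 1 : ℕ) : ℤ) - j) := by
      funext j
      have : (((2 * n + 1 : ℕ) : ℤ) - 2 * n - 1) * j = 0 := by push_cast; ring
      rw [this, zpow_zero, one_mul]
    rw [e1, altSum_const_mul, altSum_qPoch_self hq0 hq (by omega), hsgn]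
    unfold fibTerm
    have e2 : q ^ mergeExp n u * q ^ tri (2 * n + 1 - 2 * u) *
        q ^ ((u : ℤ) * ((2 * n + 1 : ℕ) : ℤ) - tri u) =
        q ^ (tri ((n : ℤ) + 1) + tri (2 * n + 1)) * q ^ ((u : ℤ) * u - n * u + 0 * u) := by
      simp only [← zpow_add₀ hq0]
      congr 1
      unfold mergeExp
      have t1 := two_mul_tri (n + 1)
      have t2 := two_mul_tri (2 * n + 1)
      have t3 := two_mul_tri (2 * n + 1 - 2 * u)
      have t4 := two_mul_tri u
      have t5 := two_mul_tri (u + 1)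
      push_cast
      linarith
    linear_combination (-(qPoch (-q) q ((n : ℤ) - u) * invPoch q (((2 * n + 1 : ℕ) : ℤ) - 2 * u) *
      invPoch q (u : ℤ) * (-1) ^ (u : ℤ) * qPoch q q (((2 * n + 1 : ℕ) : ℤ) - u)) / 2) * e2

theorem cyclicThree_even_eq (h2 : (2 : K) ≠ 0) (hq0 : q ≠ 0) (hq : ∀ j : ℕ, 0 < j → q ^ j ≠ 1)
    (n : ℕ) : cyclicThree q (2 * n) n = q ^ (tri (n + 1) + tri (2 * n)) / 2 *
      ((1 + q ^ (-2 * n - 1 : ℤ) + q ^ (-n : ℤ) - q ^ (1 - n : ℤ)) * fibSum q (2 * n) n 1 -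
        q ^ (-2 * n - 1 : ℤ) * fibSum q (2 * n) n 2 +
          q ^ (1 - 3 * n : ℤ) * fibSum q (2 * n) n 3) := by
  have hsgn : ∀ u : ℤ, sgnTri q (((2 * n : ℕ) : ℤ) - 2 * u) = q ^ tri (2 * n - 2 * u) := by
    intro u
    unfold sgnTri
    have : ((2 * n : ℕ) : ℤ) - 2 * u = 2 * n - 2 * u := by push_cast; ring
    rw [this, Even.neg_one_zpow ⟨n - u, by ring⟩]
    ring
  have h := sum_merge hq0 (2 * n) n (fun u j => sgnTri q (((2 * n : ℕ) : ℤ) - 2 * u) *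
    (1 + q ^ ((n : ℤ) - 2 * u + j) * (q ^ (-(((2 * n : ℕ) : ℤ) - 2 * u)) +
      q ^ (1 - 2 * (((2 * n : ℕ) : ℤ) - 2 * u)) * (1 - q ^ (((2 * n : ℕ) : ℤ) - 2 * u)))))
  rw [cyclicThree_eq hq0 hq]
  refine Eq.trans ?_ (h.trans ?_)
  · apply Finset.sum_congr rfl
    intro j _
    rw [multiThree_even h2 hq0 hq (by omega) (by push_cast; omega) (by push_cast; ring)]
    congr 2
    apply Finset.sum_congr rfl
    intro i _
    have e : ((2 * n : ℕ) : ℤ) - 2 * ((i : ℤ) + j) = ((2 * n : ℕ) : ℤ) - 2 * j - 2 * i := by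
      ring
    have e' : (n : ℤ) - 2 * ((i : ℤ) + j) + j = n - j - 2 * i := by ring
    rw [e, e']
    ring
  · unfold fibSum
    simp only [Finset.mul_sum]
    rw [← Finset.sum_sub_distrib, ← Finset.sum_add_distrib, Finset.mul_sum]
    apply Finset.sum_congr rfl
    intro u hu
    simp only [Finset.mem_range] at hu
    -- The weight q^(-j) cancels the q^j in the second summand of the bracket, leaving one sum with
    -- weight q^(-j) and a j-free multiple of the unweighted one. The later factors 1 - q^u and
    -- q^(2u) produce the parameters x = 2 and x = 3.
    have e1 : altSum q (2 * n + 1) (fun j : ℤ => q ^ ((((2 * n : ℕ) : ℤ) - 2 * n - 1) * j) *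
        (sgnTri q (((2 * n : ℕ) : ℤ) - 2 * u) *
        (1 + q ^ ((n : ℤ) - 2 * u + j) * (q ^ (-(((2 * n : ℕ) : ℤ) - 2 * u)) +
          q ^ (1 - 2 * (((2 * n : ℕ) : ℤ) - 2 * u)) * (1 - q ^ (((2 * n : ℕ) : ℤ) - 2 * u))))) *
        qPoch q q (((2 * n : ℕ) : ℤ) - j)) u =
        sgnTri q (((2 * n : ℕ) : ℤ) - 2 * u) *
          (altSum q (2 * n + 1) (fun j => q ^ (-j) * qPoch q q (((2 * n : ℕ) : ℤ) - j)) u +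
          (q ^ (-(n : ℤ)) + q ^ (1 - 3 * n + 2 * u : ℤ) - q ^ (1 - n : ℤ)) *
            altSum q (2 * n + 1) (fun j => qPoch q q (((2 * n : ℕ) : ℤ) - j)) u) := by
      unfold altSum
      rw [Finset.mul_sum, ← Finset.sum_add_distrib, Finset.mul_sum]
      apply Finset.sum_congr rfl
      intro j _
      have f1 : (((2 * n : ℕ) : ℤ) - 2 * n - 1) * (j : ℤ) = -j := by push_cast; ring
      have f2 : q ^ (-(n : ℤ)) =
          q ^ (-(j : ℤ)) * q ^ ((n : ℤ) - 2 * u + j) * q ^ (-(((2 * n : ℕ) : ℤ) - 2 * u)) := by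
        simp only [← zpow_add₀ hq0]
        congr 1; push_cast; ring
      have f3 : q ^ (1 - 3 * n + 2 * u : ℤ) = q ^ (-(j : ℤ)) * q ^ ((n : ℤ) - 2 * u + j) *
          q ^ (1 - 2 * (((2 * n : ℕ) : ℤ) - 2 * u)) := by
        simp only [← zpow_add₀ hq0]
        congr 1; push_cast; ring
      have f4 : q ^ (1 - n : ℤ) = q ^ (-(j : ℤ)) * q ^ ((n : ℤ) - 2 * u + j) *
          q ^ (1 - 2 * (((2 * n : ℕ) : ℤ) - 2 * u)) * q ^ (((2 * n : ℕ) : ℤ) - 2 * u) := by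
        simp only [← zpow_add₀ hq0]
        congr 1; push_cast; ring
      beta_reduce
      rw [f1, f2, f3, f4]
      ring
    rw [e1, altSum_zpow_neg_mul_qPoch_self hq0 hq (by omega),
      altSum_qPoch_self hq0 hq (by omega), hsgn]
    unfold fibTerm
    have e2 : q ^ mergeExp n u * q ^ tri (2 * n - 2 * u) *
        q ^ ((u : ℤ) * ((2 * n : ℕ) : ℤ) - tri u) =
        q ^ (tri ((n : ℤ) + 1) + tri (2 * n)) * q ^ ((u : ℤ) * u - n * u + 1 * u) := by
      simp only [← zpow_add₀ hq0]
      congr 1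
      unfold mergeExp
      have t1 := two_mul_tri (n + 1)
      have t2 := two_mul_tri (2 * n)
      have t3 := two_mul_tri (2 * n - 2 * u)
      have t4 := two_mul_tri u
      have t5 := two_mul_tri (u + 1)
      push_cast
      linarith
    have e3 : q ^ ((u : ℤ) * u - n * u + 2 * u) =
        q ^ ((u : ℤ) * u - n * u + 1 * u) * q ^ (u : ℤ) := by
      rw [← zpow_add₀ hq0]; congr 1; ring
    have e4 : q ^ (1 - 3 * n : ℤ) * q ^ ((u : ℤ) * u - n * u + 3 * u) =
        q ^ ((u : ℤ) * u - n * u + 1 * u) * q ^ (1 - 3 * n + 2 * u : ℤ) := by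
      rw [← zpow_add₀ hq0, ← zpow_add₀ hq0]; congr 1; ring
    have e5 : -(((2 * n : ℕ) : ℤ)) - 1 = -2 * n - 1 := by push_cast; ring
    rw [e3, e5]
    generalize q ^ (-2 * n - 1 : ℤ) = z1
    generalize q ^ (-n : ℤ) = z2
    generalize q ^ (1 - n : ℤ) = z3
    linear_combination (qPoch (-q) q ((n : ℤ) - u) * invPoch q (((2 * n : ℕ) : ℤ) - 2 * u) *
      invPoch q (u : ℤ) * (-1) ^ (u : ℤ) * qPoch q q (((2 * n : ℕ) : ℤ) - u) / 2) *
      ((1 + (1 - q ^ (u : ℤ)) * z1 + (z2 + q ^ (1 - 3 * n + 2 * u : ℤ) - z3)) * e2 -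
        q ^ (tri ((n : ℤ) + 1) + tri (2 * n)) * e4)

end Reduction

/-! ### Telescoping certificates for the single sums. -/

section Recurrences

variable {K : Type*} [Field K] {q : K}

/-- A telescoping relation at fixed n between x = 1, 2, 3. Once the common factorials are extracted
it is a rational identity in q, q^n and q^u, as are the next three lemmas. -/
theorem fibTerm_contiguous (h2 : (2 : K) ≠ 0) (hq0 : q ≠ 0) (hq : ∀ j : ℕ, 0 < j → q ^ j ≠ 1)
    {n u : ℤ} (hu : u ≤ 2 * n) :
    (1 + q ^ (2 * n + 1) - q ^ (n + 1)) * fibTerm q (2 * n) n 1 u -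
      (1 + q ^ 2) * fibTerm q (2 * n) n 2 u + q ^ (2 - n) * fibTerm q (2 * n) n 3 u =
    (-1) ^ u * q ^ (u * u - n * u + u) * qPoch q q (2 * n + 1 - u) * invPoch q (u - 1) *
      invPoch q (2 * n - 2 * u) * qPoch (-q) q (n - u) -
    (-1) ^ (u + 1) * q ^ ((u + 1) * (u + 1) - n * (u + 1) + (u + 1)) * qPoch q q (2 * n - u) *
      invPoch q u * invPoch q (2 * n - 2 * u - 2) * qPoch (-q) q (n - u - 1) := by
  unfold fibTerm
  have hP := qPoch_self_add_one hq0 (by omega : 0 ≤ 2 * n - u)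
  have hc := qPoch_neg_add_one h2 hq0 hq (n - u - 1)
  have a1 : 2 * n - u + 1 = 2 * n + 1 - u := by ring
  have a2 : n - u - 1 + 1 = n - u := by ring
  have a3 : (u + 1) * (u + 1) - n * (u + 1) + (u + 1) =
    (u * u - n * u) + (u + u + u + 2 - n) := by ring
  have a4 : u * u - n * u + 2 * u = (u * u - n * u) + (u + u) := by ring
  have a5 : u * u - n * u + 3 * u = (u * u - n * u) + (u + u + u) := by ring
  rw [a1] at hP
  rw [a2] at hc
  rw [hP, hc, invPoch_sub_one hq0 hq u,
    invPoch_eq hq0 hq (by ring : 2 * n - 2 * u - 2 + 1 = 2 * n - 2 * u - 1),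
    invPoch_eq hq0 hq (by ring : 2 * n - 2 * u - 1 + 1 = 2 * n - 2 * u), a3, a4, a5, one_mul]
  generalize u * u - n * u = E
  generalize qPoch q q (2 * n - u) = p0
  generalize qPoch (-q) q (n - u - 1) = c0
  generalize invPoch q u = g0
  generalize invPoch q (2 * n - 2 * u) = g1
  simp only [two_mul, zpow_add₀ hq0, zpow_sub₀ hq0, zpow_ofNat,
    zpow_add₀ (neg_ne_zero.2 one_ne_zero : (-1 : K) ≠ 0)]
  have hx := zpow_ne_zero u hq0
  have hN := zpow_ne_zero n hq0
  generalize q ^ u = x at hx ⊢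
  generalize q ^ n = Q at hN ⊢
  field_simp
  ring

/-- The certificate of `fibTerm_step_one`. -/
def stepOneCert (q Q x : K) : K :=
  -(q ^ 3 * Q ^ 4 + q ^ 2 * Q ^ 3) / x ^ 2 + (q - q ^ 2) * Q ^ 2 / x + 1 + q * Q

/-- One row of the system carrying (x = 1, x = 2) from n to n + 1; `fibTerm_step_two` is the other.
The leading coefficient of both is q^(2n+1) - 1. -/
theorem fibTerm_step_one (h2 : (2 : K) ≠ 0) (hq0 : q ≠ 0) (hq : ∀ j : ℕ, 0 < j → q ^ j ≠ 1)
    {n u : ℤ} (hu : u ≤ 2 * n) :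
    (q * (q ^ n) ^ 2 - 1) * fibTerm q (2 * n + 2) (n + 1) 1 u -
      (-(1 + q ^ 2 * q ^ n) * fibTerm q (2 * n) n 1 u + (q * (1 + q * q ^ n) / q ^ n) * fibTerm q (2 * n) n 2 u) =
    (-1) ^ (u + 1) * q ^ ((u + 1) * (u + 1) - n * (u + 1)) * qPoch q q (2 * n - u) *
      invPoch q u * invPoch q (2 * n - 2 * u) * qPoch (-q) q (n - u) *
      stepOneCert q (q ^ n) (q ^ (u + 1)) -
    (-1) ^ u * q ^ (u * u - n * u) * qPoch q q (2 * n + 1 - u) * invPoch q (u - 1) *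
      invPoch q (2 * n + 2 - 2 * u) * qPoch (-q) q (n + 1 - u) *
      stepOneCert q (q ^ n) (q ^ u) := by
  unfold fibTerm stepOneCert
  have hP := qPoch_self_add_one hq0 (by omega : 0 ≤ 2 * n - u)
  have hP' := qPoch_self_add_one hq0 (by omega : 0 ≤ 2 * n - u + 1)
  have hc := qPoch_neg_add_one h2 hq0 hq (n - u)
  have a1 : 2 * n + 1 - u = 2 * n - u + 1 := by ring
  have a2 : n + 1 - u = n - u + 1 := by ring
  have a6 : 2 * n + 2 - u = 2 * n - u + 1 + 1 := by ring
  have a3 : (u + 1) * (u + 1) - n * (u + 1) = (u * u - n * u) + (u + u + 1 - n) := by ring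
  have a4 : u * u - n * u + 1 * u = (u * u - n * u) + u := by ring
  have a5 : u * u - n * u + 2 * u = (u * u - n * u) + (u + u) := by ring
  have a7 : u * u - (n + 1) * u + 1 * u = (u * u - n * u) := by ring
  rw [a1, a6, hP', hP, a2, hc, invPoch_sub_one hq0 hq u,
    invPoch_eq hq0 hq (by ring : 2 * n - 2 * u + 1 = 2 * n + 1 - 2 * u),
    invPoch_eq hq0 hq (by ring : 2 * n + 1 - 2 * u + 1 = 2 * n + 2 - 2 * u),
    a3, a4, a5, a7]
  generalize u * u - n * u = E
  generalize qPoch q q (2 * n - u) = p0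
  generalize qPoch (-q) q (n - u) = c0
  generalize invPoch q u = g0
  generalize invPoch q (2 * n + 2 - 2 * u) = g1
  simp only [two_mul, zpow_add₀ hq0, zpow_sub₀ hq0, zpow_ofNat,
    zpow_add₀ (neg_ne_zero.2 one_ne_zero : (-1 : K) ≠ 0)]
  have hx := zpow_ne_zero u hq0
  have hN := zpow_ne_zero n hq0
  generalize q ^ u = x at hx ⊢
  generalize q ^ n = Q at hN ⊢
  field_simp
  ring

/-- The certificate of `fibTerm_step_two`. -/
def stepTwoCert (q Q x : K) : K :=
  -(q ^ 3 * Q ^ 4 + q ^ 2 * Q ^ 3) / x ^ 2 + (q * Q ^ 2 - q ^ 3 * Q ^ 4) / x + q * Q ^ 2 + q * Q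

theorem fibTerm_step_two (h2 : (2 : K) ≠ 0) (hq0 : q ≠ 0) (hq : ∀ j : ℕ, 0 < j → q ^ j ≠ 1)
    {n u : ℤ} (hu : u ≤ 2 * n) :
    (q * (q ^ n) ^ 2 - 1) * fibTerm q (2 * n + 2) (n + 1) 2 u -
      (-(1 + q ^ 3 * (q ^ n) ^ 3) * fibTerm q (2 * n) n 1 u + (q ^ 2 * (1 + q ^ n)) * fibTerm q (2 * n) n 2 u) =
    (-1) ^ (u + 1) * q ^ ((u + 1) * (u + 1) - n * (u + 1)) * qPoch q q (2 * n - u) *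
      invPoch q u * invPoch q (2 * n - 2 * u) * qPoch (-q) q (n - u) *
      stepTwoCert q (q ^ n) (q ^ (u + 1)) -
    (-1) ^ u * q ^ (u * u - n * u) * qPoch q q (2 * n + 1 - u) * invPoch q (u - 1) *
      invPoch q (2 * n + 2 - 2 * u) * qPoch (-q) q (n + 1 - u) *
      stepTwoCert q (q ^ n) (q ^ u) := by
  unfold fibTerm stepTwoCert
  have hP := qPoch_self_add_one hq0 (by omega : 0 ≤ 2 * n - u)
  have hP' := qPoch_self_add_one hq0 (by omega : 0 ≤ 2 * n - u + 1)
  have hc := qPoch_neg_add_one h2 hq0 hq (n - u)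
  have a1 : 2 * n + 1 - u = 2 * n - u + 1 := by ring
  have a2 : n + 1 - u = n - u + 1 := by ring
  have a6 : 2 * n + 2 - u = 2 * n - u + 1 + 1 := by ring
  have a3 : (u + 1) * (u + 1) - n * (u + 1) = (u * u - n * u) + (u + u + 1 - n) := by ring
  have a4 : u * u - n * u + 1 * u = (u * u - n * u) + u := by ring
  have a5 : u * u - n * u + 2 * u = (u * u - n * u) + (u + u) := by ring
  have a7 : u * u - (n + 1) * u + 2 * u = (u * u - n * u) + u := by ring
  rw [a1, a6, hP', hP, a2, hc, invPoch_sub_one hq0 hq u,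
    invPoch_eq hq0 hq (by ring : 2 * n - 2 * u + 1 = 2 * n + 1 - 2 * u),
    invPoch_eq hq0 hq (by ring : 2 * n + 1 - 2 * u + 1 = 2 * n + 2 - 2 * u),
    a3, a4, a5, a7]
  generalize u * u - n * u = E
  generalize qPoch q q (2 * n - u) = p0
  generalize qPoch (-q) q (n - u) = c0
  generalize invPoch q u = g0
  generalize invPoch q (2 * n + 2 - 2 * u) = g1
  simp only [two_mul, zpow_add₀ hq0, zpow_sub₀ hq0, zpow_ofNat,
    zpow_add₀ (neg_ne_zero.2 one_ne_zero : (-1 : K) ≠ 0)]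
  have hx := zpow_ne_zero u hq0
  have hN := zpow_ne_zero n hq0
  generalize q ^ u = x at hx ⊢
  generalize q ^ n = Q at hN ⊢
  field_simp
  ring

/-- The certificate of `fibTerm_odd_step`. -/
def oddStepCert (q Q x : K) : K :=
  -(q ^ 12 * Q ^ 6 + q ^ 10 * Q ^ 5) / x ^ 6 + (q ^ 9 + q ^ 8) * Q ^ 4 / x ^ 5 +
    q ^ 5 * Q ^ 3 / x ^ 4 - 1 / x ^ 2

theorem fibTerm_odd_step (h2 : (2 : K) ≠ 0) (hq0 : q ≠ 0) (hq : ∀ j : ℕ, 0 < j → q ^ j ≠ 1)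
    {n u : ℤ} (hu : u ≤ 2 * n + 1) :
    fibTerm q (2 * n + 5) (n + 2) 0 u + q ^ (-n - 1) * fibTerm q (2 * n + 1) n 0 u =
    (-1) ^ (u + 1) * q ^ ((u + 1) * (u + 1) - n * (u + 1)) * qPoch q q (2 * n + 1 - u) *
      invPoch q u * invPoch q (2 * n + 3 - 2 * u) * qPoch (-q) q (n + 1 - u) *
      oddStepCert q (q ^ n) (q ^ (u + 1)) -
    (-1) ^ u * q ^ (u * u - n * u) * qPoch q q (2 * n + 2 - u) * invPoch q (u - 1) *
      invPoch q (2 * n + 5 - 2 * u) * qPoch (-q) q (n + 2 - u) *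
      oddStepCert q (q ^ n) (q ^ u) := by
  unfold fibTerm oddStepCert
  have hP := qPoch_self_add_one hq0 (by omega : 0 ≤ 2 * n + 1 - u)
  have hP2 := qPoch_self_add_one hq0 (by omega : 0 ≤ 2 * n + 1 - u + 1)
  have hP3 := qPoch_self_add_one hq0 (by omega : 0 ≤ 2 * n + 1 - u + 1 + 1)
  have hP4 := qPoch_self_add_one hq0 (by omega : 0 ≤ 2 * n + 1 - u + 1 + 1 + 1)
  have hc := qPoch_neg_add_one h2 hq0 hq (n - u)
  have hc2 := qPoch_neg_add_one h2 hq0 hq (n - u + 1)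
  have a1 : 2 * n + 2 - u = 2 * n + 1 - u + 1 := by ring
  have a2 : n + 1 - u = n - u + 1 := by ring
  have b2 : n + 2 - u = n - u + 1 + 1 := by ring
  have a6 : 2 * n + 5 - u = 2 * n + 1 - u + 1 + 1 + 1 + 1 := by ring
  have a3 : (u + 1) * (u + 1) - n * (u + 1) = (u * u - n * u) + (u + u + 1 - n) := by ring
  have a4 : u * u - n * u + 0 * u = u * u - n * u := by ring
  have a7 : u * u - (n + 2) * u + 0 * u = (u * u - n * u) - u - u := by ring
  rw [a6, a1, hP4, hP3, hP2, hP, b2, a2, hc2, hc, invPoch_sub_one hq0 hq u,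
    invPoch_eq hq0 hq (by ring : 2 * n + 1 - 2 * u + 1 = 2 * n + 2 - 2 * u),
    invPoch_eq hq0 hq (by ring : 2 * n + 2 - 2 * u + 1 = 2 * n + 3 - 2 * u),
    invPoch_eq hq0 hq (by ring : 2 * n + 3 - 2 * u + 1 = 2 * n + 4 - 2 * u),
    invPoch_eq hq0 hq (by ring : 2 * n + 4 - 2 * u + 1 = 2 * n + 5 - 2 * u),
    a3, a4, a7]
  generalize u * u - n * u = E
  generalize qPoch q q (2 * n + 1 - u) = p0
  generalize qPoch (-q) q (n - u) = c0
  generalize invPoch q u = g0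
  generalize invPoch q (2 * n + 5 - 2 * u) = g1
  simp only [two_mul, zpow_add₀ hq0, zpow_sub₀ hq0, zpow_ofNat, zpow_neg,
    zpow_add₀ (neg_ne_zero.2 one_ne_zero : (-1 : K) ≠ 0)]
  have hx := zpow_ne_zero u hq0
  have hN := zpow_ne_zero n hq0
  generalize q ^ u = x at hx ⊢
  generalize q ^ n = Q at hN ⊢
  field_simp
  ring

end Recurrences

/-! ### Solving the recurrences for `fibSum`. -/

section ClosedForms

variable {K : Type*} [Field K] {q : K}

theorem sum_telescope_eq_zero {R : ℕ} {F : ℤ → K} (G : ℤ → K)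
    (h : ∀ u : ℕ, u < R → F u = G (u + 1) - G u) (h0 : G 0 = 0) (hR : G R = 0) :
    ∑ u ∈ Finset.range R, F u = 0 := by
  have := Finset.sum_range_sub (fun u : ℕ => G u) R
  rw [Nat.cast_zero, h0, hR, sub_zero] at this
  rw [← this]
  apply Finset.sum_congr rfl
  intro u hu
  rw [h u (Finset.mem_range.1 hu)]
  push_cast
  rfl

theorem fibSum_contiguous (h2 : (2 : K) ≠ 0) (hq0 : q ≠ 0) (hq : ∀ j : ℕ, 0 < j → q ^ j ≠ 1)
    (n : ℕ) : (1 + q ^ (2 * n + 1 : ℤ) - q ^ (n + 1 : ℤ)) * fibSum q (2 * n) n 1 -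
      (1 + q ^ 2) * fibSum q (2 * n) n 2 + q ^ (2 - n : ℤ) * fibSum q (2 * n) n 3 = 0 := by
  unfold fibSum
  rw [Finset.mul_sum, Finset.mul_sum, Finset.mul_sum, ← Finset.sum_sub_distrib,
    ← Finset.sum_add_distrib]
  push_cast
  refine sum_telescope_eq_zero (F := fun u => (1 + q ^ (2 * n + 1 : ℤ) - q ^ (n + 1 : ℤ)) *
      fibTerm q (2 * n) n 1 u - (1 + q ^ 2) * fibTerm q (2 * n) n 2 u +
        q ^ (2 - n : ℤ) * fibTerm q (2 * n) n 3 u)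
    (fun u => -((-1) ^ u * q ^ (u * u - n * u + u) * qPoch q q (2 * n + 1 - u) *
      invPoch q (u - 1) * invPoch q (2 * n - 2 * u) * qPoch (-q) q (n - u))) ?_ ?_ ?_
  · intro u hu
    rw [fibTerm_contiguous h2 hq0 hq (by omega)]
    have e1 : (u : ℤ) + 1 - 1 = u := by ring
    have e2 : 2 * (n : ℤ) - 2 * (u + 1) = 2 * n - 2 * u - 2 := by ring
    have e3 : (n : ℤ) - (u + 1) = n - u - 1 := by ring
    have e4 : 2 * (n : ℤ) + 1 - (u + 1) = 2 * n - u := by ring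
    rw [e1, e2, e3, e4]
    ring
  · rw [invPoch_of_neg (by omega : (0 : ℤ) - 1 < 0)]
    ring
  · rw [invPoch_of_neg (by push_cast; omega : 2 * (n : ℤ) - 2 * ((2 * n + 1 : ℕ) : ℤ) < 0)]
    ring

theorem fibSum_even_step_one (h2 : (2 : K) ≠ 0) (hq0 : q ≠ 0) (hq : ∀ j : ℕ, 0 < j → q ^ j ≠ 1)
    {n : ℕ} (hn : 1 ≤ n) :
    (q * (q ^ (n : ℤ)) ^ 2 - 1) * fibSum q (2 * (n + 1)) (n + 1) 1 =
      -(1 + q ^ 2 * q ^ (n : ℤ)) * fibSum q (2 * n) n 1 +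
        (q * (1 + q * q ^ (n : ℤ)) / q ^ (n : ℤ)) * fibSum q (2 * n) n 2 := by
  -- The sum at n + 1 is supported on u ≤ n + 1 ≤ 2n, which uses n ≥ 1; it is cut to the range of
  -- the sum at n, where the certificate is valid.
  rw [← sub_eq_zero, fibSum_eq (N := 2 * (n + 1)) (R := 2 * n + 1) _ _ (by omega)]
  unfold fibSum
  rw [Finset.mul_sum, Finset.mul_sum, Finset.mul_sum, ← Finset.sum_add_distrib,
    ← Finset.sum_sub_distrib]
  push_cast
  rw [show 2 * ((n : ℤ) + 1) = 2 * n + 2 by ring]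
  refine sum_telescope_eq_zero (F := fun u =>
      (q * (q ^ (n : ℤ)) ^ 2 - 1) * fibTerm q (2 * n + 2) (n + 1) 1 u -
        (-(1 + q ^ 2 * q ^ (n : ℤ)) * fibTerm q (2 * n) n 1 u +
          (q * (1 + q * q ^ (n : ℤ)) / q ^ (n : ℤ)) * fibTerm q (2 * n) n 2 u))
    (fun u => (-1) ^ u * q ^ (u * u - n * u) * qPoch q q (2 * n + 1 - u) *
      invPoch q (u - 1) * invPoch q (2 * n + 2 - 2 * u) * qPoch (-q) q (n + 1 - u) *
      stepOneCert q (q ^ (n : ℤ)) (q ^ u)) ?_ ?_ ?_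
  · intro u hu
    rw [fibTerm_step_one h2 hq0 hq (by omega)]
    have e1 : (u : ℤ) + 1 - 1 = u := by ring
    have e2 : 2 * (n : ℤ) + 2 - 2 * (u + 1) = 2 * n - 2 * u := by ring
    have e3 : (n : ℤ) + 1 - (u + 1) = n - u := by ring
    have e4 : 2 * (n : ℤ) + 1 - (u + 1) = 2 * n - u := by ring
    rw [e1, e2, e3, e4]
  · rw [invPoch_of_neg (by omega : (0 : ℤ) - 1 < 0)]
    ring
  · rw [invPoch_of_neg (by push_cast; omega : 2 * (n : ℤ) + 2 - 2 * ((2 * n + 1 : ℕ) : ℤ) < 0)]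
    ring

theorem fibSum_even_step_two (h2 : (2 : K) ≠ 0) (hq0 : q ≠ 0) (hq : ∀ j : ℕ, 0 < j → q ^ j ≠ 1)
    {n : ℕ} (hn : 1 ≤ n) :
    (q * (q ^ (n : ℤ)) ^ 2 - 1) * fibSum q (2 * (n + 1)) (n + 1) 2 =
      -(1 + q ^ 3 * (q ^ (n : ℤ)) ^ 3) * fibSum q (2 * n) n 1 +
        (q ^ 2 * (1 + q ^ (n : ℤ))) * fibSum q (2 * n) n 2 := by
  rw [← sub_eq_zero, fibSum_eq (N := 2 * (n + 1)) (R := 2 * n + 1) _ _ (by omega)]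
  unfold fibSum
  rw [Finset.mul_sum, Finset.mul_sum, Finset.mul_sum, ← Finset.sum_add_distrib,
    ← Finset.sum_sub_distrib]
  push_cast
  rw [show 2 * ((n : ℤ) + 1) = 2 * n + 2 by ring]
  refine sum_telescope_eq_zero (F := fun u =>
      (q * (q ^ (n : ℤ)) ^ 2 - 1) * fibTerm q (2 * n + 2) (n + 1) 2 u -
        (-(1 + q ^ 3 * (q ^ (n : ℤ)) ^ 3) * fibTerm q (2 * n) n 1 u +
          (q ^ 2 * (1 + q ^ (n : ℤ))) * fibTerm q (2 * n) n 2 u))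
    (fun u => (-1) ^ u * q ^ (u * u - n * u) * qPoch q q (2 * n + 1 - u) *
      invPoch q (u - 1) * invPoch q (2 * n + 2 - 2 * u) * qPoch (-q) q (n + 1 - u) *
      stepTwoCert q (q ^ (n : ℤ)) (q ^ u)) ?_ ?_ ?_
  · intro u hu
    rw [fibTerm_step_two h2 hq0 hq (by omega)]
    have e1 : (u : ℤ) + 1 - 1 = u := by ring
    have e2 : 2 * (n : ℤ) + 2 - 2 * (u + 1) = 2 * n - 2 * u := by ring
    have e3 : (n : ℤ) + 1 - (u + 1) = n - u := by ring
    have e4 : 2 * (n : ℤ) + 1 - (u + 1) = 2 * n - u := by ring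
    rw [e1, e2, e3, e4]
  · rw [invPoch_of_neg (by omega : (0 : ℤ) - 1 < 0)]
    ring
  · rw [invPoch_of_neg (by push_cast; omega : 2 * (n : ℤ) + 2 - 2 * ((2 * n + 1 : ℕ) : ℤ) < 0)]
    ring

theorem fibSum_odd_step (h2 : (2 : K) ≠ 0) (hq0 : q ≠ 0) (hq : ∀ j : ℕ, 0 < j → q ^ j ≠ 1)
    {n : ℕ} (hn : 1 ≤ n) :
    fibSum q (2 * (n + 2) + 1) (n + 2) 0 = -(q ^ (-n - 1 : ℤ) * fibSum q (2 * n + 1) n 0) := by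
  rw [← sub_eq_zero, sub_neg_eq_add,
    -- The support u ≤ n + 2 fits into u ≤ 2n + 1 because n ≥ 1.
    fibSum_eq (N := 2 * (n + 2) + 1) (R := 2 * n + 2) _ _ (by omega)]
  unfold fibSum
  rw [Finset.mul_sum, ← Finset.sum_add_distrib]
  push_cast
  rw [show 2 * ((n : ℤ) + 2) + 1 = 2 * n + 5 by ring]
  refine sum_telescope_eq_zero (R := 2 * n + 1 + 1) (F := fun u =>
      fibTerm q (2 * n + 5) (n + 2) 0 u + q ^ (-n - 1 : ℤ) * fibTerm q (2 * n + 1) n 0 u)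
    (fun u => (-1) ^ u * q ^ (u * u - n * u) * qPoch q q (2 * n + 2 - u) *
      invPoch q (u - 1) * invPoch q (2 * n + 5 - 2 * u) * qPoch (-q) q (n + 2 - u) *
      oddStepCert q (q ^ (n : ℤ)) (q ^ u)) ?_ ?_ ?_
  · intro u hu
    rw [fibTerm_odd_step h2 hq0 hq (by omega)]
    have e1 : (u : ℤ) + 1 - 1 = u := by ring
    have e2 : 2 * (n : ℤ) + 5 - 2 * (u + 1) = 2 * n + 3 - 2 * u := by ring
    have e3 : (n : ℤ) + 2 - (u + 1) = n + 1 - u := by ring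
    have e4 : 2 * (n : ℤ) + 2 - (u + 1) = 2 * n + 1 - u := by ring
    rw [e1, e2, e3, e4]
  · rw [invPoch_of_neg (by omega : (0 : ℤ) - 1 < 0)]
    ring
  · rw [invPoch_of_neg
      (by push_cast; omega : 2 * (n : ℤ) + 5 - 2 * ((2 * n + 1 + 1 : ℕ) : ℤ) < 0)]
    ring

theorem fibSum_two_one (h2 : (2 : K) ≠ 0) (hq0 : q ≠ 0) (hq : ∀ j : ℕ, 0 < j → q ^ j ≠ 1) (x : ℤ) :
    fibSum q 2 1 x = 1 + q - q ^ x := by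
  rw [fibSum_eq (R := 2) _ _ (by omega), Finset.sum_range_succ, Finset.sum_range_one]
  have p2 := qPoch_mul_invPoch hq0 hq (by omega : (0 : ℤ) ≤ 2)
  have p1 := qPoch_mul_invPoch hq0 hq (by omega : (0 : ℤ) ≤ 1)
  have c1 := qPoch_neg_add_one h2 hq0 hq 0
  norm_num at c1
  norm_num [fibTerm]
  rw [c1]
  linear_combination (1 + q) * p2 - q ^ x * p1

theorem fibSum_three_one (h2 : (2 : K) ≠ 0) (hq0 : q ≠ 0) (hq : ∀ j : ℕ, 0 < j → q ^ j ≠ 1) :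
    fibSum q 3 1 0 = 0 := by
  rw [fibSum_eq (R := 2) _ _ (by omega), Finset.sum_range_succ, Finset.sum_range_one]
  have p3 := qPoch_mul_invPoch hq0 hq (by omega : (0 : ℤ) ≤ 3)
  have p1 := qPoch_mul_invPoch hq0 hq (by omega : (0 : ℤ) ≤ 1)
  have q1 := qPoch_self_add_one hq0 (by omega : (0 : ℤ) ≤ 0)
  have q2 := qPoch_self_add_one hq0 (by omega : (0 : ℤ) ≤ 1)
  have c1 := qPoch_neg_add_one h2 hq0 hq 0
  norm_num [zpow_ofNat] at c1 q1 q2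
  rw [q1] at p1 q2
  norm_num [fibTerm]
  rw [c1, q2]
  linear_combination (1 + q) * p3 - (1 + q) * ((1 - q) * invPoch q 1 + 1) * p1

theorem fibSum_five_two (h2 : (2 : K) ≠ 0) (hq0 : q ≠ 0) (hq : ∀ j : ℕ, 0 < j → q ^ j ≠ 1) :
    fibSum q 5 2 0 = -q⁻¹ := by
  rw [fibSum_eq (R := 3) _ _ (by omega), Finset.sum_range_succ, Finset.sum_range_succ,
    Finset.sum_range_one]
  have p5 := qPoch_mul_invPoch hq0 hq (by omega : (0 : ℤ) ≤ 5)
  have p3 := qPoch_mul_invPoch hq0 hq (by omega : (0 : ℤ) ≤ 3)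
  have p2 := qPoch_mul_invPoch hq0 hq (by omega : (0 : ℤ) ≤ 2)
  have p1 := qPoch_mul_invPoch hq0 hq (by omega : (0 : ℤ) ≤ 1)
  have q1 := qPoch_self_add_one hq0 (by omega : (0 : ℤ) ≤ 0)
  have q3 := qPoch_self_add_one hq0 (by omega : (0 : ℤ) ≤ 2)
  have q4 := qPoch_self_add_one hq0 (by omega : (0 : ℤ) ≤ 3)
  have c1 := qPoch_neg_add_one h2 hq0 hq 0
  have c2 := qPoch_neg_add_one h2 hq0 hq 1
  norm_num [zpow_ofNat] at c1 c2 q1 q3 q4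
  rw [q1] at p1
  rw [c1] at c2
  have t0 : fibTerm q 5 2 0 0 = (1 + q ^ 2) * (1 + q) := by
    norm_num [fibTerm]
    rw [c2]
    linear_combination (1 + q ^ 2) * (1 + q) * p5
  have t1 : fibTerm q 5 2 0 1 = -(q⁻¹ * (1 + q) * (1 + q ^ 2) * (1 + q)) := by
    norm_num [fibTerm]
    rw [c1, q4]
    field_simp
    linear_combination (1 + q) * (1 - q ^ 4) * invPoch q 1 * p3 +
      (1 + q) * (1 + q) * (1 + q ^ 2) * p1
  have t2 : fibTerm q 5 2 0 2 = 1 + q + q ^ 2 := by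
    norm_num [fibTerm]
    rw [q3]
    linear_combination (1 - q ^ 3) * invPoch q 1 * p2 + (1 + q + q ^ 2) * p1
  push_cast
  rw [t0, t1, t2]
  field_simp
  ring

/-- The recurrence has step two in n, so the parities separate: the zero at n = 1 propagates through
all odd n, and -1/q at n = 2 fixes the even n. -/
theorem fibSum_odd_closed (h2 : (2 : K) ≠ 0) (hq0 : q ≠ 0) (hq : ∀ j : ℕ, 0 < j → q ^ j ≠ 1)
    (k : ℕ) : fibSum q (2 * (2 * k + 1) + 1) (2 * k + 1) 0 = 0 ∧
      fibSum q (2 * (2 * k + 2) + 1) (2 * k + 2) 0 =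
        (-1) ^ (k + 1) * q ^ (-((k + 1) * (k + 1)) : ℤ) := by
  induction k with
  | zero =>
    have a := fibSum_three_one h2 hq0 hq
    have b := fibSum_five_two h2 hq0 hq
    norm_num [a, b]
  | succ k ih =>
    have a := fibSum_odd_step h2 hq0 hq (by omega : 1 ≤ 2 * k + 1)
    have b := fibSum_odd_step h2 hq0 hq (by omega : 1 ≤ 2 * k + 2)
    push_cast at a b ⊢
    rw [show 2 * ((k : ℤ) + 1) + 1 = 2 * k + 1 + 2 by ring,
      show 2 * ((k : ℤ) + 1) + 2 = 2 * k + 2 + 2 by ring]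
    refine ⟨?_, ?_⟩
    · refine a.trans ?_
      rw [ih.1]; ring
    · refine b.trans ?_
      rw [ih.2, show (-(((k : ℤ) + 1 + 1) * (k + 1 + 1)) : ℤ) =
        (-(2 * k + 2) - 1) + -((k + 1) * (k + 1)) by ring, zpow_add₀ hq0]
      ring

/-- One step of the first-order system for even `N`, from odd to even `n`. -/
theorem fibSum_even_of_odd (h2 : (2 : K) ≠ 0) (hq0 : q ≠ 0) (hq : ∀ j : ℕ, 0 < j → q ^ j ≠ 1)
    {n : ℕ} (hn : 1 ≤ n) (h : fibSum q (2 * n) n 2 = fibSum q (2 * n) n 1 *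
      (q⁻¹ * q ^ (n : ℤ) + q ^ (n : ℤ) - (q ^ (n : ℤ)) ^ 2)) :
    fibSum q (2 * (n + 1)) (n + 1) 1 = -q * fibSum q (2 * n) n 1 ∧
      fibSum q (2 * (n + 1)) (n + 1) 2 = fibSum q (2 * (n + 1)) (n + 1) 1 *
        (q ^ (n : ℤ) + q * q ^ (n : ℤ) - q⁻¹) := by
  have s1 := fibSum_even_step_one h2 hq0 hq hn
  have s2 := fibSum_even_step_two h2 hq0 hq hn
  -- The leading coefficient q^(2n+1) - 1; with the assumed ratio of x = 2 to x = 1, the right sides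
  -- are divisible by it.
  have hD : q * (q ^ (n : ℤ)) ^ 2 - 1 ≠ 0 := by
    have := zpow_ne_one hq (by omega : 2 * (n : ℤ) + 1 ≠ 0)
    rw [zpow_add₀ hq0, two_mul, zpow_add₀ hq0, zpow_one] at this
    rw [sub_ne_zero]
    intro h
    apply this
    rw [← h]; ring
  have hQ := zpow_ne_zero (n : ℤ) hq0
  have r1 : fibSum q (2 * (n + 1)) (n + 1) 1 = -q * fibSum q (2 * n) n 1 := by
    apply mul_left_cancel₀ hD
    rw [s1, h]
    field_simp
    ring
  refine ⟨r1, ?_⟩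
  apply mul_left_cancel₀ hD
  rw [s2, r1, h]
  field_simp
  ring

/-- One step of the first-order system for even `N`, from even to odd `n`. -/
theorem fibSum_even_of_even (h2 : (2 : K) ≠ 0) (hq0 : q ≠ 0) (hq : ∀ j : ℕ, 0 < j → q ^ j ≠ 1)
    {n : ℕ} (hn : 1 ≤ n) (h : fibSum q (2 * n) n 2 = fibSum q (2 * n) n 1 *
      (q⁻¹ * q ^ (n : ℤ) + q ^ (n : ℤ) - q⁻¹)) :
    fibSum q (2 * (n + 1)) (n + 1) 1 = (q ^ (n : ℤ))⁻¹ * fibSum q (2 * n) n 1 ∧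
      fibSum q (2 * (n + 1)) (n + 1) 2 = fibSum q (2 * (n + 1)) (n + 1) 1 *
        (q ^ (n : ℤ) + q * q ^ (n : ℤ) - q ^ 2 * (q ^ (n : ℤ)) ^ 2) := by
  have s1 := fibSum_even_step_one h2 hq0 hq hn
  have s2 := fibSum_even_step_two h2 hq0 hq hn
  have hD : q * (q ^ (n : ℤ)) ^ 2 - 1 ≠ 0 := by
    have := zpow_ne_one hq (by omega : 2 * (n : ℤ) + 1 ≠ 0)
    rw [zpow_add₀ hq0, two_mul, zpow_add₀ hq0, zpow_one] at this
    rw [sub_ne_zero]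
    intro h
    apply this
    rw [← h]; ring
  have hQ := zpow_ne_zero (n : ℤ) hq0
  have r1 : fibSum q (2 * (n + 1)) (n + 1) 1 = (q ^ (n : ℤ))⁻¹ * fibSum q (2 * n) n 1 := by
    apply mul_left_cancel₀ hD
    rw [s1, h]
    field_simp
    ring
  refine ⟨r1, ?_⟩
  apply mul_left_cancel₀ hD
  rw [s2, r1, h]
  field_simp
  ring

/-- The ratio of x = 2 to x = 1 is carried along because it reduces the 2 by 2 system to a scalar
recurrence. Its form depends on the parity of n, so odd and even steps alternate, starting from n =
1. -/
theorem fibSum_even_closed (h2 : (2 : K) ≠ 0) (hq0 : q ≠ 0) (hq : ∀ j : ℕ, 0 < j → q ^ j ≠ 1)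
    (k : ℕ) :
    (fibSum q (2 * (2 * k + 1)) ((2 * k + 1 : ℕ) : ℤ) 1 = (-1) ^ k * q ^ (-(k * k) : ℤ) ∧
      fibSum q (2 * (2 * k + 1)) ((2 * k + 1 : ℕ) : ℤ) 2 =
        fibSum q (2 * (2 * k + 1)) ((2 * k + 1 : ℕ) : ℤ) 1 *
          (q⁻¹ * q ^ ((2 * k + 1 : ℕ) : ℤ) + q ^ ((2 * k + 1 : ℕ) : ℤ) -
            (q ^ ((2 * k + 1 : ℕ) : ℤ)) ^ 2)) ∧
    (fibSum q (2 * (2 * k + 1 + 1)) ((2 * k + 1 + 1 : ℕ) : ℤ) 1 =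
        (-1) ^ (k + 1) * q ^ (1 - k * k : ℤ) ∧
      fibSum q (2 * (2 * k + 1 + 1)) ((2 * k + 1 + 1 : ℕ) : ℤ) 2 =
        fibSum q (2 * (2 * k + 1 + 1)) ((2 * k + 1 + 1 : ℕ) : ℤ) 1 *
          (q⁻¹ * q ^ ((2 * k + 1 + 1 : ℕ) : ℤ) + q ^ ((2 * k + 1 + 1 : ℕ) : ℤ) - q⁻¹)) := by
  have next : ∀ k : ℕ,
      (fibSum q (2 * (2 * k + 1)) ((2 * k + 1 : ℕ) : ℤ) 1 = (-1) ^ k * q ^ (-(k * k) : ℤ) ∧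
      fibSum q (2 * (2 * k + 1)) ((2 * k + 1 : ℕ) : ℤ) 2 =
        fibSum q (2 * (2 * k + 1)) ((2 * k + 1 : ℕ) : ℤ) 1 *
          (q⁻¹ * q ^ ((2 * k + 1 : ℕ) : ℤ) + q ^ ((2 * k + 1 : ℕ) : ℤ) -
            (q ^ ((2 * k + 1 : ℕ) : ℤ)) ^ 2)) →
      (fibSum q (2 * (2 * k + 1 + 1)) ((2 * k + 1 + 1 : ℕ) : ℤ) 1 =
        (-1) ^ (k + 1) * q ^ (1 - k * k : ℤ) ∧
      fibSum q (2 * (2 * k + 1 + 1)) ((2 * k + 1 + 1 : ℕ) : ℤ) 2 =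
        fibSum q (2 * (2 * k + 1 + 1)) ((2 * k + 1 + 1 : ℕ) : ℤ) 1 *
          (q⁻¹ * q ^ ((2 * k + 1 + 1 : ℕ) : ℤ) + q ^ ((2 * k + 1 + 1 : ℕ) : ℤ) - q⁻¹)) := by
    intro k h
    obtain ⟨a, b⟩ := fibSum_even_of_odd h2 hq0 hq (by omega : 1 ≤ 2 * k + 1) h.2
    have e : ((2 * k + 1 + 1 : ℕ) : ℤ) = ((2 * k + 1 : ℕ) : ℤ) + 1 := by push_cast; ring
    rw [e, b, a, h.1, zpow_add₀ hq0 _ 1, zpow_one, sub_eq_add_neg (1 : ℤ), zpow_add₀ hq0 1,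
      zpow_one]
    refine ⟨by ring, ?_⟩
    field_simp
  induction k with
  | zero =>
    have h0 := fun x => fibSum_two_one h2 hq0 hq x
    have start : fibSum q (2 * (2 * 0 + 1)) ((2 * 0 + 1 : ℕ) : ℤ) 1 =
        (-1) ^ 0 * q ^ (-(((0 : ℕ) : ℤ) * ((0 : ℕ) : ℤ)) : ℤ) ∧
        fibSum q (2 * (2 * 0 + 1)) ((2 * 0 + 1 : ℕ) : ℤ) 2 =
        fibSum q (2 * (2 * 0 + 1)) ((2 * 0 + 1 : ℕ) : ℤ) 1 *
          (q⁻¹ * q ^ ((2 * 0 + 1 : ℕ) : ℤ) + q ^ ((2 * 0 + 1 : ℕ) : ℤ) -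
            (q ^ ((2 * 0 + 1 : ℕ) : ℤ)) ^ 2) := by
      norm_num [h0, zpow_ofNat]
      rw [inv_mul_cancel₀ hq0]
    exact ⟨start, next 0 start⟩
  | succ k ih =>
    have start : fibSum q (2 * (2 * (k + 1) + 1)) ((2 * (k + 1) + 1 : ℕ) : ℤ) 1 =
        (-1) ^ (k + 1) * q ^ (-(((k + 1 : ℕ) : ℤ) * ((k + 1 : ℕ) : ℤ)) : ℤ) ∧
      fibSum q (2 * (2 * (k + 1) + 1)) ((2 * (k + 1) + 1 : ℕ) : ℤ) 2 =
        fibSum q (2 * (2 * (k + 1) + 1)) ((2 * (k + 1) + 1 : ℕ) : ℤ) 1 *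
          (q⁻¹ * q ^ ((2 * (k + 1) + 1 : ℕ) : ℤ) + q ^ ((2 * (k + 1) + 1 : ℕ) : ℤ) -
            (q ^ ((2 * (k + 1) + 1 : ℕ) : ℤ)) ^ 2) := by
      obtain ⟨a, b⟩ := fibSum_even_of_even h2 hq0 hq (by omega : 1 ≤ 2 * k + 1 + 1) ih.2.2
      have e : ((2 * (k + 1) + 1 : ℕ) : ℤ) = ((2 * k + 1 + 1 : ℕ) : ℤ) + 1 := by push_cast; ring
      have e' : 2 * (k + 1) + 1 = 2 * k + 1 + 1 + 1 := by ring
      rw [e, e', b, a, ih.2.1]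
      have e2 : (q ^ ((2 * k + 1 + 1 : ℕ) : ℤ))⁻¹ * q ^ (1 - k * k : ℤ) =
          q ^ (-(((k + 1 : ℕ) : ℤ) * ((k + 1 : ℕ) : ℤ)) : ℤ) := by
        rw [← zpow_neg, ← zpow_add₀ hq0]
        congr 1; push_cast; ring
      rw [mul_left_comm, e2, zpow_add₀ hq0 _ 1, zpow_one]
      refine ⟨rfl, ?_⟩
      field_simp
    exact ⟨start, next (k + 1) start⟩

end ClosedForms

/-! ### Assembling the values of U_3 and W_3. -/

section Values

variable {K : Type*} [Field K] {q : K}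

/-- `fibSum_contiguous` eliminates x = 3. With Q = q^n, inserting the ratios of `fibSum_even_closed`
turns the bracket into (3/Q - q) for odd n and (3/Q - 1/Q^2) for even n, times the x = 1 sum; hence
the coefficient 3 in W_3. -/
theorem cyclicThree_even_reduced (h2 : (2 : K) ≠ 0) (hq0 : q ≠ 0)
    (hq : ∀ j : ℕ, 0 < j → q ^ j ≠ 1) (n : ℕ) :
    cyclicThree q (2 * n) n = q ^ (tri (n + 1) + tri (2 * n)) / 2 *
      ((2 * (q ^ (n : ℤ))⁻¹ - q * (q ^ (n : ℤ))⁻¹) * fibSum q (2 * n) n 1 +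
        q * (q ^ (n : ℤ))⁻¹ ^ 2 * fibSum q (2 * n) n 2) := by
  rw [cyclicThree_even_eq h2 hq0 hq]
  have c := fibSum_contiguous h2 hq0 hq n
  congr 1
  have e1 : q ^ (-2 * n - 1 : ℤ) = (q ^ (n : ℤ))⁻¹ ^ 2 * q⁻¹ := by
    rw [zpow_sub₀ hq0, zpow_one, neg_mul, zpow_neg, two_mul, zpow_add₀ hq0]
    field_simp
  have e2 : q ^ (1 - n : ℤ) = q * (q ^ (n : ℤ))⁻¹ := by
    rw [zpow_sub₀ hq0, zpow_one, div_eq_mul_inv]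
  have e3 : q ^ (1 - 3 * n : ℤ) = q ^ (2 - n : ℤ) * ((q ^ (n : ℤ))⁻¹ ^ 2 * q⁻¹) := by
    rw [← e1, ← zpow_add₀ hq0]; congr 1; ring
  have e4 : q ^ (2 * n + 1 : ℤ) = q * (q ^ (n : ℤ)) ^ 2 := by
    rw [zpow_add₀ hq0, zpow_one, two_mul, zpow_add₀ hq0]; ring
  have e5 : q ^ (n + 1 : ℤ) = q * q ^ (n : ℤ) := by
    rw [zpow_add₀ hq0, zpow_one, mul_comm]
  rw [e4, e5] at c
  rw [e1, e2, e3, zpow_neg]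
  have hQ := zpow_ne_zero (n : ℤ) hq0
  generalize q ^ (n : ℤ) = Q at hQ c ⊢
  generalize fibSum q (2 * n) n 1 = w1 at c ⊢
  generalize fibSum q (2 * n) n 2 = w2 at c ⊢
  generalize fibSum q (2 * n) n 3 = w3 at c ⊢
  have c' : q ^ (2 - n : ℤ) * w3 = (1 + q ^ 2) * w2 - (1 + q * Q ^ 2 - q * Q) * w1 := by
    linear_combination c
  have c'' : q ^ (2 - n : ℤ) * (Q⁻¹ ^ 2 * q⁻¹) * w3 =
      (Q⁻¹ ^ 2 * q⁻¹) * ((1 + q ^ 2) * w2 - (1 + q * Q ^ 2 - q * Q) * w1) := by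
    rw [← c']; ring
  rw [c'']
  field_simp
  ring

theorem multiU_three_odd (h2 : (2 : K) ≠ 0) (hq0 : q ≠ 0) (hq : ∀ j : ℕ, 0 < j → q ^ j ≠ 1)
    (m : ℕ) : multiU q 3 (2 * m + 1) = 0 := by
  have v := (fibSum_odd_closed h2 hq0 hq m).1
  rw [multiU_three, cyclicThree_odd_eq h2 hq0 hq]
  push_cast
  rw [v, mul_zero]

theorem multiU_three_even (h2 : (2 : K) ≠ 0) (hq0 : q ≠ 0) (hq : ∀ j : ℕ, 0 < j → q ^ j ≠ 1)
    (m : ℕ) : multiU q 3 (2 * m + 2) =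
      (-1) ^ m / 2 * q ^ (9 * ((m : ℤ) + 1) ^ 2 + 3 * (m + 1)) := by
  have v := (fibSum_odd_closed h2 hq0 hq m).2
  rw [multiU_three, cyclicThree_odd_eq h2 hq0 hq]
  push_cast
  rw [v]
  have e : q ^ (9 * ((m : ℤ) + 1) ^ 2 + 3 * (m + 1)) =
      q ^ (tri (2 * m + 2 + 1) + tri (2 * (2 * m + 2) + 1)) *
        q ^ (-((m + 1) * (m + 1)) : ℤ) := by
    rw [← zpow_add₀ hq0]
    congr 1
    have t1 := two_mul_tri (2 * m + 2 + 1)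
    have t2 := two_mul_tri (2 * (2 * m + 2) + 1)
    linarith
  rw [e, pow_succ]
  ring

theorem multiW_three_odd (h2 : (2 : K) ≠ 0) (hq0 : q ≠ 0) (hq : ∀ j : ℕ, 0 < j → q ^ j ≠ 1)
    (m : ℕ) : multiW q 3 (2 * m + 1) = (-1) ^ (m + 1) / 2 *
      (q ^ (9 * ((m : ℤ) + 1) ^ 2 - 9 * (m + 1) + 3) -
        3 * q ^ (9 * ((m : ℤ) + 1) ^ 2 - 11 * (m + 1) + 3)) := by
  obtain ⟨v1, v2⟩ := (fibSum_even_closed h2 hq0 hq m).1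
  rw [multiW_three, cyclicThree_even_reduced h2 hq0 hq, v2, v1]
  have e1 : q ^ (9 * ((m : ℤ) + 1) ^ 2 - 9 * (m + 1) + 3) =
      q ^ (tri (((2 * m + 1 : ℕ) : ℤ) + 1) + tri (2 * ((2 * m + 1 : ℕ) : ℤ))) *
        q ^ (-(m * m) : ℤ) * q := by
    rw [← zpow_add₀ hq0, ← zpow_add_one₀ hq0]
    congr 1
    have t1 := two_mul_tri (((2 * m + 1 : ℕ) : ℤ) + 1)
    have t2 := two_mul_tri (2 * ((2 * m + 1 : ℕ) : ℤ))
    push_cast at t1 t2 ⊢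
    linarith
  have e2 : q ^ (9 * ((m : ℤ) + 1) ^ 2 - 11 * (m + 1) + 3) =
      q ^ (tri (((2 * m + 1 : ℕ) : ℤ) + 1) + tri (2 * ((2 * m + 1 : ℕ) : ℤ))) *
        q ^ (-(m * m) : ℤ) * (q ^ ((2 * m + 1 : ℕ) : ℤ))⁻¹ := by
    rw [← zpow_neg, ← zpow_add₀ hq0, ← zpow_add₀ hq0]
    congr 1
    have t1 := two_mul_tri (((2 * m + 1 : ℕ) : ℤ) + 1)
    have t2 := two_mul_tri (2 * ((2 * m + 1 : ℕ) : ℤ))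
    push_cast at t1 t2 ⊢
    linarith
  rw [e1, e2]
  have hQ := zpow_ne_zero ((2 * m + 1 : ℕ) : ℤ) hq0
  generalize q ^ ((2 * m + 1 : ℕ) : ℤ) = Q at hQ ⊢
  field_simp
  ring

theorem multiW_three_even (h2 : (2 : K) ≠ 0) (hq0 : q ≠ 0) (hq : ∀ j : ℕ, 0 < j → q ^ j ≠ 1)
    (m : ℕ) : multiW q 3 (2 * m + 1 + 1) = (-1) ^ m / 2 *
      (q ^ (9 * ((m : ℤ) + 1) ^ 2 - 3 * (m + 1)) -
        3 * q ^ (9 * ((m : ℤ) + 1) ^ 2 - (m + 1))) := by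
  obtain ⟨v1, v2⟩ := (fibSum_even_closed h2 hq0 hq m).2
  rw [multiW_three, cyclicThree_even_reduced h2 hq0 hq, v2, v1]
  have e1 : q ^ (9 * ((m : ℤ) + 1) ^ 2 - 3 * (m + 1)) =
      q ^ (tri (((2 * m + 1 + 1 : ℕ) : ℤ) + 1) + tri (2 * ((2 * m + 1 + 1 : ℕ) : ℤ))) *
        q ^ (1 - m * m : ℤ) * ((q ^ ((2 * m + 1 + 1 : ℕ) : ℤ))⁻¹ *
          (q ^ ((2 * m + 1 + 1 : ℕ) : ℤ))⁻¹) := by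
    rw [← zpow_neg, ← zpow_add₀ hq0, ← zpow_add₀ hq0, ← zpow_add₀ hq0]
    congr 1
    have t1 := two_mul_tri (((2 * m + 1 + 1 : ℕ) : ℤ) + 1)
    have t2 := two_mul_tri (2 * ((2 * m + 1 + 1 : ℕ) : ℤ))
    push_cast at t1 t2 ⊢
    linarith
  have e2 : q ^ (9 * ((m : ℤ) + 1) ^ 2 - (m + 1)) =
      q ^ (tri (((2 * m + 1 + 1 : ℕ) : ℤ) + 1) + tri (2 * ((2 * m + 1 + 1 : ℕ) : ℤ))) *
        q ^ (1 - m * m : ℤ) * (q ^ ((2 * m + 1 + 1 : ℕ) : ℤ))⁻¹ := by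
    rw [← zpow_neg, ← zpow_add₀ hq0, ← zpow_add₀ hq0]
    congr 1
    have t1 := two_mul_tri (((2 * m + 1 + 1 : ℕ) : ℤ) + 1)
    have t2 := two_mul_tri (2 * ((2 * m + 1 + 1 : ℕ) : ℤ))
    push_cast at t1 t2 ⊢
    linarith
  rw [e1, e2]
  have hQ := zpow_ne_zero ((2 * m + 1 + 1 : ℕ) : ℤ) hq0
  generalize q ^ ((2 * m + 1 + 1 : ℕ) : ℤ) = Q at hQ ⊢
  field_simp
  ring

end Values

theorem mainTheorem3 {K : Type*} [Field K] (h2 : (2 : K) ≠ 0) (q : K) (hq0 : q ≠ 0)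
    (hq : ∀ j : ℕ, 0 < j → q ^ j ≠ 1) (n : ℕ) (hn : 1 ≤ n) :
    multiU q 2 n = 0 ∧
    (∀ k : ℤ, (n : ℤ) = 2 * k - 1 → multiU q 3 n = 0) ∧
    (∀ k : ℤ, (n : ℤ) = 2 * k →
      multiU q 3 n = (-1) ^ (k - 1) / 2 * q ^ (9 * k ^ 2 + 3 * k)) ∧
    multiW q 2 n = (-1) ^ n * q ^ ((n : ℤ) * (3 * n - 1) / 2) ∧
    (∀ k : ℤ, (n : ℤ) = 2 * k - 1 →
      multiW q 3 n = (-1) ^ k / 2 *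
        (q ^ (9 * k ^ 2 - 9 * k + 3) - 3 * q ^ (9 * k ^ 2 - 11 * k + 3))) ∧
    (∀ k : ℤ, (n : ℤ) = 2 * k →
      multiW q 3 n = (-1) ^ (k - 1) / 2 *
        (q ^ (9 * k ^ 2 - 3 * k) - 3 * q ^ (9 * k ^ 2 - k))) := by
  -- Since n ≥ 1, both n = 2k - 1 and n = 2k force k ≥ 1.
  have index : ∀ k : ℤ, 1 ≤ k → ∃ m : ℕ, k = m + 1 := fun k hk => ⟨(k - 1).toNat, by omega⟩
  refine ⟨?_, ?_, ?_, ?_, ?_, ?_⟩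
  · rw [multiU_two, cyclicTwo_odd h2 hq0 hq]
  · intro k hk
    obtain ⟨m, rfl⟩ := index k (by omega)
    obtain rfl : n = 2 * m + 1 := by omega
    exact multiU_three_odd h2 hq0 hq m
  · intro k hk
    obtain ⟨m, rfl⟩ := index k (by omega)
    obtain rfl : n = 2 * m + 2 := by omega
    rw [multiU_three_even h2 hq0 hq m, add_sub_cancel_right, zpow_natCast]
  · rw [multiW_two, cyclicTwo_even h2 hq0 hq]
  · intro k hk
    obtain ⟨m, rfl⟩ := index k (by omega)
    obtain rfl : n = 2 * m + 1 := by omega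
    rw [multiW_three_odd h2 hq0 hq m, ← Nat.cast_succ, zpow_natCast]
  · intro k hk
    obtain ⟨m, rfl⟩ := index k (by omega)
    obtain rfl : n = 2 * m + 1 + 1 := by omega
    rw [multiW_three_even h2 hq0 hq m, add_sub_cancel_right, zpow_natCast]
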